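/- **Setting.** Let $n\ge 0$, $N=2^n$, and let $U_1,\dots,U_M$ be $n$-qubit quantum circuits, i.e. sequences of layers of single-qubit and two-qubit unitary gates acting on disjoint qubits within a layer; the depth is the number of layers, and every $U_j$ has depth at most $d$. Let $|a_j\rangle=U_j|0^n\rangle\in\mathbb C^N$, let norms $\|a_j\|\ge 0$ be given classically, and let $A=\sum_{j=1}^M\|a_j\|\,|a_j\rangle\langle j|\in\mathbb C^{N\times M}$, $A\neq 0$. Let $0\neq c\in\mathbb C^M$ be given classically, $\varepsilon>0$ and $0<\delta<1$. Vector norms are Euclidean and matrix norms spectral; $X^{-1}$ is the Moore–Penrose pseudo-inverse of $X$ (the usual inverse if $X$ is invertible), and $\kappa=\|A\|\|A^{-1}\|$ is the ratio of the largest to the smallest nonzero singular value of $A$. Put $V=A^\dagger A$, $\alpha^*=V^{-1}c$, $\Gamma_2=\max_j\|a_j\|^2$, $$\lambda=\frac{\varepsilon}{2\|A^{-1}\|^8\|A\|^4\|c\|},\qquad F=\frac{\kappa^{12}\|A^{-1}\|^4\|c\|^2\bigl(\|A\|^2\|\alpha^*\|+\varepsilon+\|c\|\bigr)^2}{\varepsilon^4},\qquad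 T=C\,M F+\frac{M}{\|A\|^4},$$ where $C$ is a constant. **Algorithm 2** (the values $\lambda$ and $S$ being supplied). For all $j,k\in[M]$ run, independently, $S=\lceil\Gamma_2^2\,T\log(2/\delta)\rceil$ times each the Hadamard tests for the real part and for the imaginary part of $\langle 0|U_j^\dagger U_k|0\rangle=\langle a_j|a_k\rangle$; in each run the control qubit is measured, and the outcome $0$ has probability $(1+\mathrm{Re}\langle a_j|a_k\rangle)/2$, respectively $(1+\mathrm{Im}\langle a_j|a_k\rangle)/2$. If $Z_{jk}$ and $Z'_{jk}$ are the numbers of outcomes $0$, put $\hat v_{jk}=(2Z_{jk}/S-1)+i\,(2Z'_{jk}/S-1)$ and $\hat V_{jk}=\|a_j\|\|a_k\|\hat v_{jk}$. Set $\hat Q=\hat V^2+\lambda I$, compute classically $\hat\alpha=\hat Q^{-1}\hat V c$, the solution of the shifted system $(\hat V^2+\lambda I)\alpha=\hat Vc$, and output $s=(\hat\alpha_1\|a_1\|,\dots,\hat\alpha_M\|a_M\|)$. **Running time.** A run of a Hadamard test costs the depth of its circuit (over single-qubit and two-qubit gates, on $n+1$ qubits) plus one; the classical part is a straight-line program, depending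 on $M$ only, in which each complex arithmetic operation costs one. **Theorem.** There are universal constants $C,K>0$ such that, for all data as above, Algorithm 2 can be implemented (by exact circuits for its Hadamard tests and a straight-line program for its classical part) so that: 1. with probability at least $1-\delta$, $\hat Q$ is invertible and $\hat y=\sum_{j=1}^M s_j|a_j\rangle$ satisfies $$\|A^\dagger\hat y-c\|-\min_{y\in\mathbb C^N}\|A^\dagger y-c\|\le\varepsilon;$$ 2. with $$R=\frac{\Gamma_2^2M^3\kappa^{12}\|A^{-1}\|^4\|c\|^2\bigl(\|A\|^2\|\alpha^*\|+\varepsilon+\|c\|\bigr)^2}{\varepsilon^4}+\frac{\Gamma_2^2M^3}{\|A\|^4},$$ the running time is at most $K\bigl((n+1)(d+1)\,(R\log(2/\delta)+M^2)+M^3\bigr)$; 3. if moreover the columns of $A$ are linearly independent and $\varepsilon\le\|c\|$, the running time is at most $K\,(n+1)(d+1)\,R\,\log(2/\delta)$. In particular, when $d$ is polylogarithmic in $N$, the running time is $\tilde O(R+M^3)$, and in the case of item 3 it is $\tilde O(R)$. -/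

import Mathlib

noncomputable section

namespace SkewedLS

/-! ### Norms, pseudo-inverse, condition number -/

/-- The Euclidean norm of a complex vector. -/
def l2norm {ι : Type} [Fintype ι] (v : ι → ℂ) : ℝ :=
  ‖(WithLp.toLp 2 v : EuclideanSpace ℂ ι)‖

/-- The spectral norm of a complex matrix (its largest singular value): the operator norm
with respect to Euclidean norms. -/
def specNorm {m n : Type} [Fintype m] [Fintype n] [DecidableEq n] (A : Matrix m n ℂ) : ℝ :=
  ‖LinearMap.toContinuousLinearMap (Matrix.toEuclideanLin A)‖

/-- The Moore-Penrose pseudo-inverse `A⁺ = W diag(σᵢ²)⁺ W† A†`, where `A† A = W diag(σᵢ²) W†`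
is an eigendecomposition and `⁺` on the diagonal replaces every nonzero entry by its reciprocal
(in Lean `0⁻¹ = 0`). -/
def pinv {m n : Type} [Fintype m] [Fintype n] [DecidableEq n] (A : Matrix m n ℂ) :
    Matrix n m ℂ :=
  let h := Matrix.isHermitian_conjTranspose_mul_self A
  (h.eigenvectorUnitary : Matrix n n ℂ)
    * Matrix.diagonal (fun i => (((h.eigenvalues i)⁻¹ : ℝ) : ℂ))
    * (h.eigenvectorUnitary : Matrix n n ℂ).conjTranspose * A.conjTranspose

/-- The condition number `κ(A) = ‖A‖ ‖A⁺‖`, the ratio of the largest to the smallest nonzero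
singular value. -/
def cond {m n : Type} [Fintype m] [Fintype n] [DecidableEq m] [DecidableEq n]
    (A : Matrix m n ℂ) : ℝ :=
  specNorm A * specNorm (pinv A)

/-! ### Quantum circuits made of single-qubit and two-qubit gates -/

/-- A gate: an arbitrary unitary on one or two of the qubits in `Q`. -/
structure Gate (Q : Type) [DecidableEq Q] where
  qubits : Finset Q
  nonempty : qubits.Nonempty
  card_le : qubits.card ≤ 2
  mat : Matrix (qubits → Bool) (qubits → Bool) ℂ
  unitary : mat ∈ Matrix.unitaryGroup (qubits → Bool) ℂ

/-- The action of a gate on all qubits: its own unitary on its qubits, tensored with the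
identity on the others.  The computational basis is `Q → Bool`. -/
def Gate.toMatrix {Q : Type} [Fintype Q] [DecidableEq Q] (g : Gate Q) :
    Matrix (Q → Bool) (Q → Bool) ℂ := fun x y =>
  if ∀ i, i ∉ g.qubits → x i = y i then g.mat (fun i => x i) (fun i => y i) else 0

/-- One layer of a circuit: gates acting on pairwise disjoint sets of qubits. -/
structure Layer (Q : Type) [DecidableEq Q] where
  gates : List (Gate Q)
  disjoint : gates.Pairwise (fun g h => Disjoint g.qubits h.qubits)

/-- The unitary of a layer (its gates commute, so the order is irrelevant). -/
def Layer.toMatrix {Q : Type} [Fintype Q] [DecidableEq Q] (L : Layer Q) :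
    Matrix (Q → Bool) (Q → Bool) ℂ :=
  (L.gates.map Gate.toMatrix).prod

/-- A circuit is a sequence of layers, the head of the list being executed first. -/
structure Circuit (Q : Type) [DecidableEq Q] where
  layers : List (Layer Q)

/-- The depth of a circuit: its number of layers. -/
def Circuit.depth {Q : Type} [DecidableEq Q] (C : Circuit Q) : ℕ := C.layers.length

/-- The unitary implemented by a circuit. -/
def Circuit.toMatrix {Q : Type} [Fintype Q] [DecidableEq Q] (C : Circuit Q) :
    Matrix (Q → Bool) (Q → Bool) ℂ :=
  C.layers.foldl (fun acc L => L.toMatrix * acc) 1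

/-- The basis state in which every qubit is `0`. -/
def zeroState (Q : Type) : Q → Bool := fun _ => false

/-- The state that the circuit prepares from the all-zero state. -/
def Circuit.state {Q : Type} [Fintype Q] [DecidableEq Q] (C : Circuit Q) : (Q → Bool) → ℂ :=
  fun x => C.toMatrix x (zeroState Q)

/-- Born rule: run the circuit on the all-zero state and measure qubit `q` in the computational
basis (`false` is the outcome `0`); the probability of outcome `v`. -/
def Circuit.outcomeProb {Q : Type} [Fintype Q] [DecidableEq Q] (C : Circuit Q) (q : Q)
    (v : Bool) : ℝ :=
  ∑ x : Q → Bool, if x q = v then ‖C.state x‖ ^ 2 else 0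

/-- The law of the measurement outcome. -/
def Circuit.outcomeLaw {Q : Type} [Fintype Q] [DecidableEq Q] (C : Circuit Q) (q : Q) :
    MeasureTheory.Measure Bool :=
  ∑ v : Bool, ENNReal.ofReal (C.outcomeProb q v) • MeasureTheory.Measure.dirac v

/-! ### The Hadamard test

The qubits of the test are `Option Q`: the control qubit `none` and the qubits `some q`. -/

/-- A one-qubit matrix acting on the control qubit. -/
def onControl {Q : Type} [Fintype Q] [DecidableEq Q] (h : Matrix Bool Bool ℂ) :
    Matrix (Option Q → Bool) (Option Q → Bool) ℂ := fun x y =>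
  if ∀ q, x (some q) = y (some q) then h (x none) (y none) else 0

/-- Controlled-`U` with control qubit `none`. -/
def controlled {Q : Type} [Fintype Q] [DecidableEq Q] (U : Matrix (Q → Bool) (Q → Bool) ℂ) :
    Matrix (Option Q → Bool) (Option Q → Bool) ℂ := fun x y =>
  if x none = y none then
    (if x none = true then U (fun q => x (some q)) (fun q => y (some q))
      else if ∀ q, x (some q) = y (some q) then 1 else 0)
  else 0

/-- The Hadamard gate. -/
def hadamard : Matrix Bool Bool ℂ := fun a b =>
  if a = true ∧ b = true then -(((Real.sqrt 2)⁻¹ : ℝ) : ℂ) else (((Real.sqrt 2)⁻¹ : ℝ) : ℂ)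

/-- The identity (for `im = false`) or the gate `diag(1, -i)` (for `im = true`). -/
def phase (im : Bool) : Matrix Bool Bool ℂ :=
  Matrix.diagonal (fun a => if a = true ∧ im = true then -Complex.I else 1)

/-- The circuit `T` implements the Hadamard test of `{|0⟩, U}`: Hadamard gate on the control
qubit, controlled-`U`, a phase gate on the control qubit if the imaginary part is wanted, and
again a Hadamard gate.  Measuring the control qubit then gives `0` with probability
`(1 + Re ⟨0|U|0⟩)/2` for `im = false`, and `(1 + Im ⟨0|U|0⟩)/2` for `im = true`. -/
def IsHadamardTest {Q : Type} [Fintype Q] [DecidableEq Q] (T : Circuit (Option Q)) (im : Bool)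
    (U : Matrix (Q → Bool) (Q → Bool) ℂ) : Prop :=
  T.toMatrix = onControl hadamard * onControl (phase im) * controlled U * onControl hadamard

/-! ### The linear system and its approximate solutions -/

/-- The matrix `A = ∑ⱼ ‖aⱼ‖ |aⱼ⟩⟨j|`, where `|aⱼ⟩ = Uⱼ|0⟩`. -/
def sysMatrix {n M : ℕ} (U : Fin M → Circuit (Fin n)) (a : Fin M → ℝ) :
    Matrix (Fin n → Bool) (Fin M) ℂ := fun x j => (a j : ℂ) * (U j).state x

/-- `y` satisfies `‖A† y - c‖ - min_z ‖A† z - c‖ ≤ ε`. -/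
def IsApproxSolution {m : Type} [Fintype m] {M : ℕ} (A : Matrix m (Fin M) ℂ) (c : Fin M → ℂ)
    (ε : ℝ) (y : m → ℂ) : Prop :=
  l2norm (A.conjTranspose.mulVec y - c) - (⨅ z : m → ℂ, l2norm (A.conjTranspose.mulVec z - c)) ≤ ε

/-- `Γ₂ = maxⱼ ‖aⱼ‖²`. -/
def gammaTwo {M : ℕ} (a : Fin M → ℝ) : ℝ := ⨆ j, a j ^ 2

/-- `α* = V⁺ c` with `V = A† A`. -/
def alphaStar {m : Type} [Fintype m] {M : ℕ} (A : Matrix m (Fin M) ℂ) (c : Fin M → ℂ) :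
    Fin M → ℂ :=
  (pinv (A.conjTranspose * A)).mulVec c

/-! ### The algorithm -/

/-- The shift `λ = ε / (2 ‖A⁺‖⁸ ‖A‖⁴ ‖c‖)`. -/
def shift {m : Type} [Fintype m] [DecidableEq m] {M : ℕ} (A : Matrix m (Fin M) ℂ)
    (c : Fin M → ℂ) (ε : ℝ) : ℝ :=
  ε / (2 * specNorm (pinv A) ^ 8 * specNorm A ^ 4 * l2norm c)

/-- `κ¹² ‖A⁺‖⁴ ‖c‖² (‖A‖² ‖α*‖ + ε + ‖c‖)² / ε⁴`. -/
def mainFactor {m : Type} [Fintype m] [DecidableEq m] {M : ℕ} (A : Matrix m (Fin M) ℂ)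
    (c : Fin M → ℂ) (ε : ℝ) : ℝ :=
  cond A ^ 12 * specNorm (pinv A) ^ 4 * l2norm c ^ 2
    * (specNorm A ^ 2 * l2norm (alphaStar A c) + ε + l2norm c) ^ 2 / ε ^ 4

/-- `T = C · M κ¹² ‖A⁺‖⁴ ‖c‖² (‖A‖² ‖α*‖ + ε + ‖c‖)² / ε⁴ + M / ‖A‖⁴`. -/
def sampleT {m : Type} [Fintype m] [DecidableEq m] {M : ℕ} (C : ℝ) (A : Matrix m (Fin M) ℂ)
    (c : Fin M → ℂ) (ε : ℝ) : ℝ :=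
  C * (M * mainFactor A c ε) + M / specNorm A ^ 4

/-- The number of repetitions of each Hadamard test: `Γ₂² T log(2/δ)`, rounded up, where `δ` is
the admitted failure probability. -/
def shots {m : Type} [Fintype m] [DecidableEq m] {M : ℕ} (C : ℝ) (A : Matrix m (Fin M) ℂ)
    (a : Fin M → ℝ) (c : Fin M → ℂ) (ε δ : ℝ) : ℕ :=
  ⌈gammaTwo a ^ 2 * sampleT C A c ε * Real.log (2 / δ)⌉₊

/-- The estimate of `⟨aⱼ|aₖ⟩` from the numbers `z j k im` of outcomes `0` among `S` runs. -/
def vHat {M : ℕ} (S : ℕ) (z : Fin M → Fin M → Bool → ℕ) (j k : Fin M) : ℂ :=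
  (2 * (z j k false : ℂ) / (S : ℂ) - 1) + (2 * (z j k true : ℂ) / (S : ℂ) - 1) * Complex.I

/-- The estimate `V̂ⱼₖ = ‖aⱼ‖ ‖aₖ‖ v̂ⱼₖ` of `V = A† A`. -/
def VHat {M : ℕ} (a : Fin M → ℝ) (S : ℕ) (z : Fin M → Fin M → Bool → ℕ) :
    Matrix (Fin M) (Fin M) ℂ := fun j k => (a j : ℂ) * (a k : ℂ) * vHat S z j k

/-- `Q̂ = V̂² + λ I`. -/
def QHat {M : ℕ} (a : Fin M → ℝ) (lam : ℝ) (S : ℕ) (z : Fin M → Fin M → Bool → ℕ) :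
    Matrix (Fin M) (Fin M) ℂ := VHat a S z ^ 2 + (lam : ℂ) • 1

/-- `α̂ = Q̂⁻¹ V̂ c`, for invertible `Q̂`. -/
def alphaHat {M : ℕ} (a : Fin M → ℝ) (c : Fin M → ℂ) (lam : ℝ) (S : ℕ)
    (z : Fin M → Fin M → Bool → ℕ) : Fin M → ℂ :=
  ((QHat a lam S z)⁻¹).mulVec ((VHat a S z).mulVec c)

/-- The measurement record: the outcome of run `r` of the Hadamard test `(j, k, im)`. -/
abbrev Record (M S : ℕ) : Type := Fin M × Fin M × Bool × Fin S → Bool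

/-- The law of the measurement record: all runs of all tests are independent, and each follows
the Born rule for the control qubit of its circuit. -/
def recordLaw {n M : ℕ} (test : Fin M → Fin M → Bool → Circuit (Option (Fin n))) (S : ℕ) :
    MeasureTheory.Measure (Record M S) :=
  MeasureTheory.Measure.pi (fun t => (test t.1 t.2.1 t.2.2.1).outcomeLaw none)

/-- The number of outcomes `0` of the test `(j, k, im)`. -/
def zeroCount {M S : ℕ} (ω : Record M S) (j k : Fin M) (im : Bool) : ℕ :=
  (Finset.univ.filter (fun r : Fin S => ω (j, k, im, r) = false)).card

/-! ### The classical part: straight-line programs with unit-cost complex arithmetic -/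

/-- An instruction of a program with registers `R`; the first register is the destination. -/
inductive Instr (R : Type) where
  | one (d : R)
  | imag (d : R)
  | conj (d x : R)
  | add (d x y : R)
  | sub (d x y : R)
  | mul (d x y : R)
  | div (d x y : R)

open Classical in
/-- The effect of an instruction on the memory. -/
def Instr.exec {R : Type} (mem : R → ℂ) : Instr R → (R → ℂ)
  | .one d => Function.update mem d 1
  | .imag d => Function.update mem d Complex.I
  | .conj d x => Function.update mem d (star (mem x))
  | .add d x y => Function.update mem d (mem x + mem y)
  | .sub d x y => Function.update mem d (mem x - mem y)
  | .mul d x y => Function.update mem d (mem x * mem y)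
  | .div d x y => Function.update mem d (mem x / mem y)

/-- A straight-line program with input registers `I` and further registers `W`, which hold `0`
at the start; `out` names the registers that hold the outputs at the end. -/
structure Program (I O : Type) where
  W : Type
  code : List (Instr (I ⊕ W))
  out : O → I ⊕ W

/-- The output of a program. -/
def Program.eval {I O : Type} (P : Program I O) (input : I → ℂ) : O → ℂ := fun o =>
  (P.code.foldl Instr.exec (Sum.elim input (fun _ => 0))) (P.out o)

/-- The running time of a program: its number of instructions. -/
def Program.steps {I O : Type} (P : Program I O) : ℕ := P.code.length

/-- The inputs of the classical part of the algorithm. -/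
inductive PostInput (M : ℕ) where
  | count (j k : Fin M) (im : Bool)
  | shots
  | norm (j : Fin M)
  | shift
  | rhs (j : Fin M)

/-- The values of these inputs. -/
def postInput {M : ℕ} (a : Fin M → ℝ) (c : Fin M → ℂ) (lam : ℝ) (S : ℕ)
    (z : Fin M → Fin M → Bool → ℕ) : PostInput M → ℂ
  | .count j k im => (z j k im : ℂ)
  | .shots => (S : ℂ)
  | .norm j => (a j : ℂ)
  | .shift => (lam : ℂ)
  | .rhs j => c j

/-- The program carries out the classical part of the algorithm: from the measured counts it
computes `s = (α̂₁ ‖a₁‖, …, α̂_M ‖a_M‖)`, whatever the data for which `Q̂` is invertible. -/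
def ComputesCoefficients {M : ℕ} (P : Program (PostInput M) (Fin M)) : Prop :=
  ∀ (a : Fin M → ℝ) (c : Fin M → ℂ) (lam : ℝ) (S : ℕ) (z : Fin M → Fin M → Bool → ℕ),
    IsUnit (QHat a lam S z).det →
      ∀ j, P.eval (postInput a c lam S z) j = alphaHat a c lam S z j * (a j : ℂ)

/-- The running time of the hybrid algorithm: every run of a Hadamard test costs the depth of its
circuit and one step for the measurement and the update of its counter; then the classical
program is executed. -/
def runTime {n M : ℕ} (test : Fin M → Fin M → Bool → Circuit (Option (Fin n))) (S : ℕ)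
    (P : Program (PostInput M) (Fin M)) : ℕ :=
  (∑ j, ∑ k, ∑ im, S * ((test j k im).depth + 1)) + P.steps

/-- The rate `Γ₂² M³ κ¹² ‖A⁺‖⁴ ‖c‖² (‖A‖² ‖α*‖ + ε + ‖c‖)² / ε⁴ + Γ₂² M³ / ‖A‖⁴`. -/
def rate {m : Type} [Fintype m] [DecidableEq m] {M : ℕ} (A : Matrix m (Fin M) ℂ)
    (a : Fin M → ℝ) (c : Fin M → ℂ) (ε : ℝ) : ℝ :=
  gammaTwo a ^ 2 * M ^ 3 * mainFactor A c ε + gammaTwo a ^ 2 * M ^ 3 / specNorm A ^ 4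

end SkewedLS

end

/-!
The estimate `V̂` of the Gram matrix `V = A† A` is unbiased, and each of its bilinear forms is a
weighted sum of independent signs, so Hoeffding's inequality and a net on the unit sphere bound
`‖V̂ - V‖` by a multiple of `Γ₂ √(M log(2/δ) / S)` with probability `1 - δ`. Since
`V c = V² α*`, the exact solution `(V² + λ)⁻¹ V c` differs from `α*` by `λ (V² + λ)⁻¹ α*`, and a
resolvent estimate shows that replacing `V` by `V̂` costs no more than the remaining part of the
error budget. A Hadamard test has depth `O((n + 1)(d + 1))`, since controlling a gate on two qubits
takes boundedly many gates on at most two qubits and the gates of a layer, now sharing the control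
qubit, run in sequence. The shifted system is solved in `O(M³)` operations by orthogonalizing its
rows: without pivoting or branching, this is a straight-line program, and invertibility alone keeps
its divisors nonzero.
-/

noncomputable section

namespace SkewedLS

open Matrix
open scoped Matrix.Norms.L2Operator

/-! ### Operators acting on some of the qubits -/

section ActOn

lemma forall_notMem_range_trans {P Q R : Type} {ι : P ↪ Q} {κ : Q ↪ R} {p : R → Prop} :
    (∀ r ∉ Set.range (ι.trans κ), p r) ↔
      (∀ r ∉ Set.range κ, p r) ∧ ∀ q ∉ Set.range ι, p (κ q) := by
  refine ⟨fun h => ⟨fun r hr => h r ?_, fun q hq => h _ ?_⟩, fun ⟨h, h'⟩ r hr => ?_⟩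
  · rintro ⟨q, rfl⟩
    exact hr ⟨ι q, rfl⟩
  · rintro ⟨i, hi⟩
    exact hq ⟨i, κ.injective hi⟩
  · by_cases hrκ : r ∈ Set.range κ
    · obtain ⟨q, rfl⟩ := hrκ
      refine h' q ?_
      rintro ⟨i, rfl⟩
      exact hr ⟨i, rfl⟩
    · exact h r hrκ

variable {P Q R : Type} [Fintype P] [Fintype Q] [DecidableEq Q] [Fintype R] [DecidableEq R]

/-- A basis state of the qubits `Q` as a pair: its restriction to the qubits `P`, embedded in `Q`
by `ι`, and its restriction to the remaining ones. -/
def splitAlong (ι : P ↪ Q) :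
    (Q → Bool) ≃ (P → Bool) × ({q // q ∉ Set.range ι} → Bool) :=
  (Equiv.piEquivPiSubtypeProd (· ∈ Set.range ι) _).trans
    (Equiv.prodCongr (Equiv.arrowCongr (Equiv.ofInjective ι ι.injective).symm (Equiv.refl _))
      (Equiv.refl _))

/-- The operator `m` on the qubits `P`, seen as an operator on the larger set of qubits `Q`:
`m ⊗ 1` with respect to the embedding `ι` of `P` in `Q`. -/
def actOn (ι : P ↪ Q) (m : Matrix (P → Bool) (P → Bool) ℂ) : Matrix (Q → Bool) (Q → Bool) ℂ :=
  (kroneckerMap (· * ·) m 1).submatrix (splitAlong ι) (splitAlong ι)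

lemma actOn_apply (ι : P ↪ Q) (m : Matrix (P → Bool) (P → Bool) ℂ) (x y : Q → Bool) :
    actOn ι m x y = if ∀ q ∉ Set.range ι, x q = y q then m (x ∘ ι) (y ∘ ι) else 0 := by
  have hrest : (splitAlong ι x).2 = (splitAlong ι y).2 ↔ ∀ q ∉ Set.range ι, x q = y q := by
    rw [funext_iff, Subtype.forall]
    rfl
  rw [actOn, submatrix_apply, kroneckerMap_apply, one_apply, mul_ite, mul_one, mul_zero]
  exact if_congr hrest rfl rfl

lemma actOn_mul [DecidableEq P] (ι : P ↪ Q) (m m' : Matrix (P → Bool) (P → Bool) ℂ) :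
    actOn ι (m * m') = actOn ι m * actOn ι m' := by
  rw [actOn, actOn, actOn, submatrix_mul_equiv, ← mul_kronecker_mul, Matrix.one_mul]

lemma actOn_diagonal (ι : P ↪ Q) (d : (P → Bool) → ℂ) :
    actOn ι (diagonal d) = diagonal fun x => d (x ∘ ι) := by
  rw [actOn, ← diagonal_one, diagonal_kronecker_diagonal, submatrix_diagonal_equiv]
  simp only [mul_one]
  rfl

@[simp]
lemma actOn_one (ι : P ↪ Q) : actOn ι (1 : Matrix (P → Bool) (P → Bool) ℂ) = 1 := by
  rw [← diagonal_one, actOn_diagonal, diagonal_one]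

lemma actOn_conjTranspose (ι : P ↪ Q) (m : Matrix (P → Bool) (P → Bool) ℂ) :
    actOn ι mᴴ = (actOn ι m)ᴴ := by
  rw [actOn, actOn, conjTranspose_submatrix, conjTranspose_kronecker, conjTranspose_one]

lemma actOn_mem_unitaryGroup [DecidableEq P] (ι : P ↪ Q) {m : Matrix (P → Bool) (P → Bool) ℂ}
    (hm : m ∈ unitaryGroup (P → Bool) ℂ) : actOn ι m ∈ unitaryGroup (Q → Bool) ℂ := by
  rw [mem_unitaryGroup_iff, star_eq_conjTranspose] at *
  rw [← actOn_conjTranspose, ← actOn_mul, hm, actOn_one]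

lemma actOn_actOn (κ : Q ↪ R) (ι : P ↪ Q) (m : Matrix (P → Bool) (P → Bool) ℂ) :
    actOn κ (actOn ι m) = actOn (ι.trans κ) m := by
  ext x y
  simp only [actOn_apply, forall_notMem_range_trans, ite_and]
  rfl

lemma Gate.toMatrix_eq_actOn (g : Gate Q) :
    g.toMatrix = actOn (Function.Embedding.subtype (· ∈ g.qubits)) g.mat := by
  ext x y
  rw [actOn_apply, Gate.toMatrix]
  refine if_congr ?_ rfl rfl
  simp

end ActOn

/-! ### Products of gates -/

section GateProduct

variable {P Q : Type} [Fintype P] [Fintype Q] [DecidableEq Q]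

/-- `X` is a product of at most `k` gates. -/
def IsGateProduct (k : ℕ) (X : Matrix (Q → Bool) (Q → Bool) ℂ) : Prop :=
  ∃ gates : List (Gate Q), gates.length ≤ k ∧ (gates.map Gate.toMatrix).prod = X

namespace IsGateProduct

variable {k k' : ℕ} {X Y : Matrix (Q → Bool) (Q → Bool) ℂ}

lemma one : IsGateProduct 0 (1 : Matrix (Q → Bool) (Q → Bool) ℂ) := ⟨[], le_rfl, rfl⟩

lemma mono (h : IsGateProduct k X) (hk : k ≤ k') : IsGateProduct k' X :=
  h.imp fun _ hl => ⟨hl.1.trans hk, hl.2⟩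

lemma mul (hX : IsGateProduct k X) (hY : IsGateProduct k' Y) : IsGateProduct (k + k') (X * Y) := by
  obtain ⟨l, hl, rfl⟩ := hX
  obtain ⟨l', hl', rfl⟩ := hY
  exact ⟨l ++ l', by simpa using add_le_add hl hl', by simp⟩

lemma list_prod {G : Type} (f : G → Matrix (Q → Bool) (Q → Bool) ℂ)
    (hf : ∀ g, IsGateProduct k (f g)) (l : List G) :
    IsGateProduct (k * l.length) (l.map f).prod := by
  induction l with
  | nil => exact one
  | cons g l ih => simpa [mul_add, add_comm] using (hf g).mul ih

lemma actOn_of_card_le_two [DecidableEq P] [Nonempty P] (hP : Fintype.card P ≤ 2) (ι : P ↪ Q)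
    {m : Matrix (P → Bool) (P → Bool) ℂ} (hm : m ∈ unitaryGroup (P → Bool) ℂ) :
    IsGateProduct 1 (actOn ι m) := by
  let e : P ↪ {q // q ∈ Finset.univ.map ι} := ⟨fun i => ⟨ι i, by simp⟩, fun i j hij =>
    ι.injective (congrArg Subtype.val hij)⟩
  refine ⟨[⟨Finset.univ.map ι, by simp, by simpa using hP, actOn e m,
    actOn_mem_unitaryGroup e hm⟩], le_rfl, ?_⟩
  simp only [List.map_cons, List.map_nil, List.prod_singleton, Gate.toMatrix_eq_actOn, actOn_actOn]
  rfl

lemma actOn [DecidableEq P] {X : Matrix (P → Bool) (P → Bool) ℂ} (hX : IsGateProduct k X)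
    (ι : P ↪ Q) : IsGateProduct k (actOn ι X) := by
  obtain ⟨l, hl, rfl⟩ := hX
  have hprod : SkewedLS.actOn ι (l.map Gate.toMatrix).prod =
      (l.map fun g => SkewedLS.actOn ι g.toMatrix).prod := by
    clear hl
    induction l with
    | nil => simp
    | cons g l ih => simp [SkewedLS.actOn_mul, ih]
  rw [hprod]
  refine (list_prod (k := 1) _ (fun g => ?_) l).mono (by rwa [one_mul])
  rw [Gate.toMatrix_eq_actOn, actOn_actOn]
  have : Nonempty {q // q ∈ g.qubits} := g.nonempty.to_subtype
  exact actOn_of_card_le_two (by simpa using g.card_le) _ g.unitary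

lemma conjTranspose (hX : IsGateProduct k X) : IsGateProduct k Xᴴ := by
  obtain ⟨l, hl, rfl⟩ := hX
  rw [conjTranspose_list_prod, List.map_map, ← List.map_reverse]
  refine (list_prod (k := 1) _ (fun g => ?_) l.reverse).mono (by simpa using hl)
  have : Nonempty {q // q ∈ g.qubits} := g.nonempty.to_subtype
  rw [Function.comp_apply, Gate.toMatrix_eq_actOn, ← actOn_conjTranspose]
  exact actOn_of_card_le_two (by simpa using g.card_le) _ (Unitary.star_mem g.unitary)

lemma exists_circuit (hX : IsGateProduct k X) :
    ∃ C : Circuit Q, C.depth ≤ k ∧ C.toMatrix = X := by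
  obtain ⟨l, hl, rfl⟩ := hX
  refine ⟨⟨l.reverse.map fun g => ⟨[g], List.pairwise_singleton _ _⟩⟩, by simpa [Circuit.depth],
    ?_⟩
  simp [Circuit.toMatrix, Layer.toMatrix, List.prod_eq_foldr, List.foldr_map]

end IsGateProduct

lemma Gate.toMatrix_mem_unitaryGroup (g : Gate Q) : g.toMatrix ∈ unitaryGroup (Q → Bool) ℂ := by
  rw [Gate.toMatrix_eq_actOn]
  exact actOn_mem_unitaryGroup _ g.unitary

lemma Layer.toMatrix_mem_unitaryGroup (L : Layer Q) : L.toMatrix ∈ unitaryGroup (Q → Bool) ℂ :=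
  list_prod_mem (by simpa using fun g _ => g.toMatrix_mem_unitaryGroup)

lemma Circuit.toMatrix_eq_prod (C : Circuit Q) :
    C.toMatrix = (C.layers.reverse.map Layer.toMatrix).prod := by
  rw [List.prod_eq_foldr, List.foldr_map, List.foldr_reverse, Circuit.toMatrix]

lemma Circuit.toMatrix_mem_unitaryGroup (C : Circuit Q) :
    C.toMatrix ∈ unitaryGroup (Q → Bool) ℂ := by
  rw [Circuit.toMatrix_eq_prod]
  exact list_prod_mem (by simpa using fun L _ => L.toMatrix_mem_unitaryGroup)

lemma length_le_card_of_pairwise_disjoint {α : Type*} [Fintype α] {l : List (Finset α)}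
    (hl : l.Pairwise Disjoint) (hne : ∀ s ∈ l, s.Nonempty) : l.length ≤ Fintype.card α := by
  classical
  have hnodup : l.Nodup := by
    refine hl.imp_of_mem fun {s t} hs _ hst heq => (hne s hs).ne_empty ?_
    rwa [← heq, disjoint_self] at hst
  calc l.length = ∑ s ∈ l.toFinset, 1 := by simp [List.toFinset_card_of_nodup hnodup]
    _ ≤ ∑ s ∈ l.toFinset, s.card :=
      Finset.sum_le_sum fun s hs => (hne s (List.mem_toFinset.1 hs)).card_pos
    _ = (l.toFinset.biUnion id).card := by
      refine (Finset.card_biUnion fun s hs t ht hst => ?_).symm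
      exact hl.forall (List.mem_toFinset.1 hs) (List.mem_toFinset.1 ht) hst
    _ ≤ Fintype.card α := Finset.card_le_univ _

lemma Layer.length_gates_le (L : Layer Q) : L.gates.length ≤ Fintype.card Q := by
  simpa using length_le_card_of_pairwise_disjoint (l := L.gates.map Gate.qubits)
    (List.pairwise_map.2 L.disjoint) (by simpa using fun g _ => g.nonempty)

end GateProduct

/-! ### Controlled operators -/

section Controlled

variable {P Q : Type}

/-- The operator applying `B b` to the qubits `some q` when the control qubit `none` holds `b`. -/
def selectOp (B : Bool → Matrix (Q → Bool) (Q → Bool) ℂ) :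
    Matrix (Option Q → Bool) (Option Q → Bool) ℂ :=
  (blockDiagonal B).submatrix
    (Equiv.piOptionEquivProd.trans (Equiv.prodComm _ _))
    (Equiv.piOptionEquivProd.trans (Equiv.prodComm _ _))

lemma selectOp_apply (B : Bool → Matrix (Q → Bool) (Q → Bool) ℂ) (x y : Option Q → Bool) :
    selectOp B x y = if x none = y none then B (x none) (x ∘ some) (y ∘ some) else 0 := rfl

lemma selectOp_conjTranspose (B : Bool → Matrix (Q → Bool) (Q → Bool) ℂ) :
    (selectOp B)ᴴ = selectOp fun b => (B b)ᴴ := by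
  rw [selectOp, conjTranspose_submatrix, blockDiagonal_conjTranspose]
  rfl

lemma selectOp_one [Fintype Q] : selectOp (1 : Bool → Matrix (Q → Bool) (Q → Bool) ℂ) = 1 := by
  rw [selectOp, blockDiagonal_one, submatrix_one_equiv]

variable [Fintype Q] [DecidableEq Q]

lemma selectOp_mul (B B' : Bool → Matrix (Q → Bool) (Q → Bool) ℂ) :
    selectOp B * selectOp B' = selectOp (B * B') := by
  rw [selectOp, selectOp, submatrix_mul_equiv, ← blockDiagonal_mul]
  rfl

lemma controlled_eq_selectOp (U : Matrix (Q → Bool) (Q → Bool) ℂ) :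
    controlled U = selectOp fun b => bif b then U else 1 := by
  ext x y
  rw [selectOp_apply, controlled]
  refine if_congr Iff.rfl ?_ rfl
  cases x none <;> simp [one_apply, funext_iff, Function.comp_def]

lemma actOn_some_eq_selectOp (U : Matrix (Q → Bool) (Q → Bool) ℂ) :
    actOn Function.Embedding.some U = selectOp fun _ => U := by
  ext x y
  rw [selectOp_apply, actOn_apply]
  exact if_congr (by simp [Option.forall]) rfl rfl

@[simp]
lemma controlled_one : controlled (1 : Matrix (Q → Bool) (Q → Bool) ℂ) = 1 := by
  rw [controlled_eq_selectOp, ← selectOp_one]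
  congr with b : 1
  cases b <;> rfl

lemma controlled_mul (U V : Matrix (Q → Bool) (Q → Bool) ℂ) :
    controlled (U * V) = controlled U * controlled V := by
  simp only [controlled_eq_selectOp, selectOp_mul]
  congr with b : 1
  cases b <;> simp

lemma controlled_conjTranspose (U : Matrix (Q → Bool) (Q → Bool) ℂ) :
    controlled Uᴴ = (controlled U)ᴴ := by
  simp only [controlled_eq_selectOp, selectOp_conjTranspose]
  congr with b : 1
  cases b <;> simp

lemma controlled_mem_unitaryGroup {U : Matrix (Q → Bool) (Q → Bool) ℂ}
    (hU : U ∈ unitaryGroup (Q → Bool) ℂ) : controlled U ∈ unitaryGroup (Option Q → Bool) ℂ := by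
  rw [mem_unitaryGroup_iff, star_eq_conjTranspose] at *
  rw [← controlled_conjTranspose, ← controlled_mul, hU, controlled_one]

lemma controlled_mul_mul_conjTranspose {W : Matrix (Q → Bool) (Q → Bool) ℂ}
    (hW : W ∈ unitaryGroup (Q → Bool) ℂ) (X : Matrix (Q → Bool) (Q → Bool) ℂ) :
    controlled (W * X * Wᴴ) =
      actOn Function.Embedding.some W * controlled X * (actOn Function.Embedding.some W)ᴴ := by
  rw [mem_unitaryGroup_iff, star_eq_conjTranspose] at hW
  simp only [controlled_eq_selectOp, actOn_some_eq_selectOp, selectOp_conjTranspose, selectOp_mul]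
  congr with b : 1
  cases b <;> simp [hW]

lemma controlled_actOn [Fintype P] [DecidableEq P] (ι : P ↪ Q)
    (m : Matrix (P → Bool) (P → Bool) ℂ) :
    controlled (actOn ι m) = actOn ι.optionMap (controlled m) := by
  ext x y
  have hrange : (∀ o ∉ Set.range ι.optionMap, x o = y o) ↔
      ∀ q ∉ Set.range ι, x (some q) = y (some q) := by
    simp [Option.forall, Option.exists]
  rw [actOn_apply, controlled]
  by_cases h : ∀ q ∉ Set.range ι, x (some q) = y (some q)
  · have hsome : (∀ q, x (some q) = y (some q)) ↔ ∀ i, x (some (ι i)) = y (some (ι i)) := by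
      refine ⟨fun h' i => h' _, fun h' q => ?_⟩
      by_cases hq : q ∈ Set.range ι
      · obtain ⟨i, rfl⟩ := hq
        exact h' i
      · exact h q hq
    rw [if_pos (hrange.2 h), actOn_apply, if_pos h, controlled]
    exact if_congr Iff.rfl (if_congr Iff.rfl rfl (if_congr hsome rfl rfl)) rfl
  · have hall : ¬∀ q, x (some q) = y (some q) := fun h' => h fun q _ => h' q
    rw [if_neg (mt hrange.1 h), actOn_apply, if_neg h, if_neg hall, ite_self, ite_self]

lemma onControl_eq_actOn (h : Matrix Bool Bool ℂ) :
    onControl (Q := Q) h =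
      actOn (.punit none : Unit ↪ Option Q) (h.submatrix (· ()) (· ())) := by
  ext x y
  rw [actOn_apply, onControl]
  exact if_congr (by simp [Option.forall, Function.Embedding.punit]) rfl rfl

end Controlled

section UnitaryDiagonalization

variable {ι : Type*} [Fintype ι] [DecidableEq ι] {m : Matrix ι ι ℂ}

lemma exists_norm_eq_one_isUnit_sub (m : Matrix ι ι ℂ) :
    ∃ t : ℂ, ‖t‖ = 1 ∧ IsUnit (t • 1 - m).det := by
  have hinf : (Metric.sphere (0 : ℂ) 1).Infinite :=
    (isPreconnected_sphere (by simp) 0 1).infinite_of_nontrivial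
      ⟨1, by simp, -1, by simp, by norm_num⟩
  have hfin : {t : ℂ | m.charpoly.IsRoot t}.Finite :=
    Polynomial.finite_setOfPred_isRoot m.charpoly_monic.ne_zero
  obtain ⟨t, ht, hroot⟩ := (hinf.sdiff hfin).nonempty
  refine ⟨t, by simpa using ht, ?_⟩
  rwa [isUnit_iff_ne_zero, smul_one_eq_diagonal, ← scalar_apply, ← eval_charpoly]

lemma isHermitian_mul_inv {X Y : Matrix ι ι ℂ} (hX : IsUnit X.det) (h : (Xᴴ * Y).IsHermitian) :
    (Y * X⁻¹).IsHermitian := by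
  have heq : Y * X⁻¹ = (X⁻¹)ᴴ * (Xᴴ * Y) * X⁻¹ := by
    rw [← Matrix.mul_assoc, ← conjTranspose_mul, mul_nonsing_inv X hX, conjTranspose_one,
      Matrix.one_mul]
  exact heq ▸ isHermitian_conjTranspose_mul_mul _ h

/-- The Cayley transform `i (t + m) (t - m)⁻¹` of `m`. For unitary `m` and `t` on the unit circle
outside the spectrum of `m` it is Hermitian. -/
def cayley (t : ℂ) (m : Matrix ι ι ℂ) : Matrix ι ι ℂ := Complex.I • (t • 1 + m) * (t • 1 - m)⁻¹

lemma isHermitian_cayley (hm : m ∈ unitaryGroup ι ℂ) {t : ℂ} (ht : ‖t‖ = 1)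
    (hdet : IsUnit (t • 1 - m).det) : (cayley t m).IsHermitian := by
  have hmm : mᴴ * m = 1 := mem_unitaryGroup_iff'.1 hm
  have htt : t * star t = 1 := by
    rw [Complex.star_def, Complex.mul_conj', ht, Complex.ofReal_one, one_pow]
  have hmul : (t • 1 - m)ᴴ * (t • 1 + m) = star t • m - t • mᴴ := by
    simp only [conjTranspose_sub, conjTranspose_smul, conjTranspose_one, Matrix.sub_mul,
      Matrix.mul_add, Matrix.smul_mul, Matrix.mul_smul, Matrix.one_mul, Matrix.mul_one, hmm,
      smul_sub, smul_smul, htt, one_smul]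
    abel
  refine isHermitian_mul_inv hdet ?_
  rw [Matrix.mul_smul, hmul, IsHermitian, conjTranspose_smul, conjTranspose_sub, conjTranspose_smul,
    conjTranspose_smul, conjTranspose_conjTranspose, star_star, Complex.star_def, Complex.conj_I,
    neg_smul, ← smul_neg, neg_sub]

lemma cayley_add_I_mul {t : ℂ} (hdet : IsUnit (t • 1 - m).det) :
    (cayley t m + Complex.I • 1) * m = t • (cayley t m - Complex.I • 1) := by
  have hmul : cayley t m * (t • 1 - m) = Complex.I • (t • 1 + m) :=
    nonsing_inv_mul_cancel_right _ _ hdet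
  rw [Matrix.mul_sub, Matrix.mul_smul, Matrix.mul_one, sub_eq_iff_eq_add] at hmul
  rw [smul_sub, hmul, Matrix.add_mul, Matrix.smul_mul, Matrix.one_mul, smul_add,
    smul_comm t Complex.I]
  abel

lemma exists_eq_conj_diagonal_of_mem_unitaryGroup (hm : m ∈ unitaryGroup ι ℂ) :
    ∃ W ∈ unitaryGroup ι ℂ, ∃ d : ι → ℂ, (∀ i, ‖d i‖ = 1) ∧ m = W * diagonal d * Wᴴ := by
  obtain ⟨t, ht, hdet⟩ := exists_norm_eq_one_isUnit_sub m
  have hH := isHermitian_cayley hm ht hdet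
  set W : Matrix ι ι ℂ := hH.eigenvectorUnitary.1
  set l := hH.eigenvalues
  have hW : W ∈ unitaryGroup ι ℂ := hH.eigenvectorUnitary.2
  have hWW : W * Wᴴ = 1 := mem_unitaryGroup_iff.1 hW
  have hWW' : Wᴴ * W = 1 := mem_unitaryGroup_iff'.1 hW
  have hmul (f g : ι → ℂ) : W * diagonal f * Wᴴ * (W * diagonal g * Wᴴ) =
      W * diagonal (fun i => f i * g i) * Wᴴ := by
    rw [← diagonal_mul_diagonal]
    simp only [Matrix.mul_assoc, ← Matrix.mul_assoc Wᴴ W, hWW', Matrix.one_mul]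
  have hspec (z : ℂ) : cayley t m + z • 1 = W * diagonal (fun i => l i + z) * Wᴴ := by
    have h := hH.spectral_theorem
    rw [Unitary.conjStarAlgAut_apply] at h
    rw [← diagonal_add, Matrix.mul_add, Matrix.add_mul, ← smul_one_eq_diagonal, Matrix.mul_smul,
      Matrix.mul_one, Matrix.smul_mul, hWW]
    exact congrArg (· + z • 1) h
  have hne (i : ι) : (l i : ℂ) + Complex.I ≠ 0 := fun h => by simpa using congrArg Complex.im h
  refine ⟨W, hW, fun i => (l i + Complex.I)⁻¹ * (t * (l i + -Complex.I)), fun i => ?_, ?_⟩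
  · have hconj : star ((l i : ℂ) + Complex.I) = l i + -Complex.I := by simp
    rw [norm_mul, norm_mul, norm_inv, ht, ← hconj, norm_star, one_mul,
      inv_mul_cancel₀ (norm_ne_zero_iff.2 (hne i))]
  · calc m = W * diagonal (fun i => (l i + Complex.I)⁻¹ * (l i + Complex.I)) * Wᴴ * m := by
          simp only [inv_mul_cancel₀ (hne _), diagonal_one, Matrix.mul_one, hWW, Matrix.one_mul]
      _ = W * diagonal (fun i => ((l i : ℂ) + Complex.I)⁻¹) * Wᴴ *
            (t • (W * diagonal (fun i => l i + -Complex.I) * Wᴴ)) := by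
          rw [← hmul, Matrix.mul_assoc, ← hspec, ← hspec, cayley_add_I_mul hdet, neg_smul,
            sub_eq_add_neg]
      _ = _ := by
          rw [← Matrix.smul_mul, ← Matrix.mul_smul, ← diagonal_smul, hmul]
          rfl

end UnitaryDiagonalization

/-! ### Controlled gates from two-qubit gates -/

section ControlledGate

lemma permMatrix_mul_diagonal_mul_conjTranspose {α : Type*} [Fintype α] [DecidableEq α]
    (σ : Equiv.Perm α) (d : α → ℂ) :
    σ.permMatrix ℂ * diagonal d * (σ.permMatrix ℂ)ᴴ = diagonal (d ∘ σ) := by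
  rw [conjTranspose_permMatrix, Equiv.Perm.permMatrix, Equiv.Perm.permMatrix,
    PEquiv.toMatrix_toPEquiv_mul, PEquiv.mul_toMatrix_toPEquiv]
  exact submatrix_diagonal_equiv _ σ

lemma permMatrix_mem_unitaryGroup {α : Type*} [Fintype α] [DecidableEq α] (σ : Equiv.Perm α) :
    σ.permMatrix ℂ ∈ unitaryGroup α ℂ := by
  have h := permMatrix_mul_diagonal_mul_conjTranspose σ 1
  rw [Pi.one_comp, diagonal_one', Matrix.mul_one] at h
  exact mem_unitaryGroup_iff.2 h

lemma diagonal_mem_unitaryGroup {α : Type*} [Fintype α] [DecidableEq α] {d : α → ℂ}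
    (hd : ∀ a, ‖d a‖ = 1) : diagonal d ∈ unitaryGroup α ℂ := by
  rw [mem_unitaryGroup_iff, star_eq_conjTranspose, diagonal_conjTranspose, diagonal_mul_diagonal,
    ← diagonal_one]
  congr with a
  simp [Complex.mul_conj', hd]

/-- The permutation of the basis states performed by a controlled-NOT gate with control `p` and
target `q`. -/
def cnotPerm {P : Type} [DecidableEq P] {p q : P} (hpq : p ≠ q) : Equiv.Perm (P → Bool) :=
  Function.Involutive.toPerm (fun x => Function.update x q (xor (x p) (x q))) fun x => by
    simp [Function.update_of_ne hpq]

lemma exists_eq_mul_mul_xor (z : Bool → Bool → ℂ) (hz : ∀ a b, ‖z a b‖ = 1) :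
    ∃ f g h : Bool → ℂ, (∀ a, ‖f a‖ = 1) ∧ (∀ a, ‖g a‖ = 1) ∧ (∀ a, ‖h a‖ = 1) ∧
      ∀ a b, z a b = f a * g b * h (xor a b) := by
  have hne a b : z a b ≠ 0 := norm_ne_zero_iff.1 (by simp [hz])
  obtain ⟨r, hr⟩ := IsAlgClosed.exists_pow_nat_eq
    (z false true * z true false * z true true / z false false) two_pos
  have hnorm : ‖r‖ = 1 := by
    refine (pow_eq_one_iff_of_nonneg (norm_nonneg r) two_ne_zero).1 ?_
    simp only [← norm_pow, hr, norm_div, norm_mul, hz, mul_one, div_one]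
  rw [eq_div_iff (hne _ _)] at hr
  refine ⟨fun a => bif a then r * z false false / z false true else z false false,
    fun b => bif b then r / z true false else 1, fun c => bif c then r / z true true else 1,
    by simp [hz, hnorm], by simp [hz, hnorm], by simp [hz, hnorm], ?_⟩
  have h01 := hne false true
  have h10 := hne true false
  have h11 := hne true true
  simp only [Bool.forall_bool, cond_false, cond_true, Bool.xor_false, Bool.xor_true, Bool.not_false,
    Bool.not_true, mul_one, true_and]
  refine ⟨?_, ?_, ?_⟩ <;> field_simp <;> linear_combination -hr

variable {P Q : Type} [Fintype P] [DecidableEq P] [Fintype Q] [DecidableEq Q]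

lemma isGateProduct_controlled_diagonal_apply (p : P) {f : Bool → ℂ} (hf : ∀ a, ‖f a‖ = 1) :
    IsGateProduct 1 (controlled (diagonal fun x : P → Bool => f (x p))) := by
  have hact : (diagonal fun x : P → Bool => f (x p)) =
      actOn (.punit p : Unit ↪ P) (diagonal fun x => f (x ())) := by
    rw [actOn_diagonal]
    rfl
  rw [hact, controlled_actOn]
  exact .actOn_of_card_le_two (by simp) _
    (controlled_mem_unitaryGroup (diagonal_mem_unitaryGroup fun _ => hf _))

lemma isGateProduct_controlled_diagonal_xor [Nonempty P] (hP : Fintype.card P ≤ 2) {p q : P}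
    (hpq : p ≠ q) {h : Bool → ℂ} (hh : ∀ a, ‖h a‖ = 1) :
    IsGateProduct 3 (controlled (diagonal fun x : P → Bool => h (xor (x p) (x q)))) := by
  have hconj : (diagonal fun x : P → Bool => h (xor (x p) (x q))) =
      (cnotPerm hpq).permMatrix ℂ * diagonal (fun x => h (x q)) *
        ((cnotPerm hpq).permMatrix ℂ)ᴴ := by
    rw [permMatrix_mul_diagonal_mul_conjTranspose]
    congr with x
    exact congrArg h (Function.update_self q _ x).symm
  have hcnot := permMatrix_mem_unitaryGroup (cnotPerm hpq)
  have hgate := IsGateProduct.actOn_of_card_le_two hP Function.Embedding.some hcnot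
  rw [hconj, controlled_mul_mul_conjTranspose hcnot]
  exact (hgate.mul (isGateProduct_controlled_diagonal_apply q hh)).mul hgate.conjTranspose

lemma isGateProduct_controlled_diagonal (hP : Fintype.card P = 2) {d : (P → Bool) → ℂ}
    (hd : ∀ x, ‖d x‖ = 1) : IsGateProduct 5 (controlled (diagonal d)) := by
  obtain ⟨p, q, hpq, huniv⟩ := Finset.card_eq_two.1 (Finset.card_univ.trans hP)
  have : Nonempty P := ⟨p⟩
  obtain ⟨f, g, h, hf, hg, hh, hfgh⟩ :=
    exists_eq_mul_mul_xor (fun a b => d fun i => if i = p then a else b) fun _ _ => hd _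
  have hsplit : diagonal d = (diagonal fun x => f (x p)) * (diagonal fun x => g (x q)) *
      diagonal fun x => h (xor (x p) (x q)) := by
    rw [diagonal_mul_diagonal, diagonal_mul_diagonal]
    congr with x
    rw [← hfgh]
    congr with i
    have hi : i = p ∨ i = q := by simpa [huniv] using Finset.mem_univ i
    rcases hi with rfl | rfl <;> simp [hpq.symm]
  rw [hsplit, controlled_mul, controlled_mul]
  exact ((isGateProduct_controlled_diagonal_apply p hf).mul
    (isGateProduct_controlled_diagonal_apply q hg)).mul
      (isGateProduct_controlled_diagonal_xor hP.le hpq hh)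

lemma isGateProduct_controlled_of_card_le_two [Nonempty P] (hP : Fintype.card P ≤ 2)
    {m : Matrix (P → Bool) (P → Bool) ℂ} (hm : m ∈ unitaryGroup (P → Bool) ℂ) :
    IsGateProduct 7 (controlled m) := by
  obtain ⟨W, hW, d, hd, rfl⟩ := exists_eq_conj_diagonal_of_mem_unitaryGroup hm
  have hgate := IsGateProduct.actOn_of_card_le_two hP Function.Embedding.some hW
  have hdiag : IsGateProduct 5 (controlled (diagonal d)) := by
    obtain hcard | hcard : Fintype.card P = 1 ∨ Fintype.card P = 2 := by
      have := Fintype.card_pos (α := P)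
      lia
    · obtain ⟨p, hp⟩ := Fintype.card_eq_one_iff.1 hcard
      have hfun : d = fun x => d fun _ => x p := by
        ext x
        congr with i
        rw [hp i]
      rw [hfun]
      exact (isGateProduct_controlled_diagonal_apply p
        (f := fun b => d fun _ => b) fun _ => hd _).mono (by norm_num)
    · exact isGateProduct_controlled_diagonal hcard hd
  rw [controlled_mul_mul_conjTranspose hW]
  exact (hgate.mul hdiag).mul hgate.conjTranspose

lemma isGateProduct_controlled_gate (g : Gate Q) : IsGateProduct 7 (controlled g.toMatrix) := by
  have : Nonempty {q // q ∈ g.qubits} := g.nonempty.to_subtype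
  rw [Gate.toMatrix_eq_actOn, controlled_actOn]
  exact (isGateProduct_controlled_of_card_le_two (by simpa using g.card_le) g.unitary).actOn _

lemma controlled_list_prod (l : List (Matrix (Q → Bool) (Q → Bool) ℂ)) :
    controlled l.prod = (l.map controlled).prod := by
  induction l with
  | nil => simp
  | cons X l ih => rw [List.prod_cons, controlled_mul, ih, List.map_cons, List.prod_cons]

lemma isGateProduct_controlled_layer (L : Layer Q) :
    IsGateProduct (7 * Fintype.card Q) (controlled L.toMatrix) := by
  rw [Layer.toMatrix, controlled_list_prod, List.map_map]
  exact (IsGateProduct.list_prod _ isGateProduct_controlled_gate L.gates).mono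
    (Nat.mul_le_mul_left 7 L.length_gates_le)

lemma isGateProduct_controlled_circuit (C : Circuit Q) :
    IsGateProduct (7 * Fintype.card Q * C.depth) (controlled C.toMatrix) := by
  rw [Circuit.toMatrix_eq_prod, controlled_list_prod, List.map_map, Circuit.depth,
    ← List.length_reverse]
  exact .list_prod _ isGateProduct_controlled_layer _

lemma isGateProduct_onControl {h : Matrix Bool Bool ℂ} (hh : h ∈ unitaryGroup Bool ℂ) :
    IsGateProduct 1 (onControl (Q := Q) h) := by
  rw [onControl_eq_actOn]
  refine .actOn_of_card_le_two (by simp) _ ?_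
  let e := Equiv.funUnique Unit Bool
  have hmul : h.submatrix e e * (h.submatrix e e)ᴴ = 1 := by
    rw [conjTranspose_submatrix, submatrix_mul_equiv, ← star_eq_conjTranspose,
      mem_unitaryGroup_iff.1 hh, submatrix_one_equiv]
  exact mem_unitaryGroup_iff.2 hmul

lemma hadamard_mem_unitaryGroup : hadamard ∈ unitaryGroup Bool ℂ := by
  have hsqrt : (((Real.sqrt 2)⁻¹ : ℝ) : ℂ) * (((Real.sqrt 2)⁻¹ : ℝ) : ℂ) = 1 / 2 := by
    rw [← Complex.ofReal_mul, ← mul_inv, Real.mul_self_sqrt zero_le_two]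
    norm_num
  rw [mem_unitaryGroup_iff, star_eq_conjTranspose]
  ext a b
  rw [mul_apply]
  simp only [conjTranspose_apply, Fintype.sum_bool, hadamard]
  cases a <;> cases b <;> simp at hsqrt ⊢ <;> linear_combination 2 * hsqrt

lemma phase_mem_unitaryGroup (im : Bool) : phase im ∈ unitaryGroup Bool ℂ :=
  diagonal_mem_unitaryGroup fun a => by split_ifs <;> simp

lemma exists_hadamardTest (U V : Circuit Q) {d : ℕ} (hU : U.depth ≤ d) (hV : V.depth ≤ d)
    (im : Bool) :
    ∃ T : Circuit (Option Q), IsHadamardTest T im (U.toMatrixᴴ * V.toMatrix) ∧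
      T.depth ≤ 14 * ((Fintype.card Q + 1) * (d + 1)) := by
  have hUV : IsGateProduct (7 * Fintype.card Q * d + 7 * Fintype.card Q * d)
      (controlled (U.toMatrixᴴ * V.toMatrix)) := by
    rw [controlled_mul, controlled_conjTranspose]
    exact ((isGateProduct_controlled_circuit U).conjTranspose.mono
      (Nat.mul_le_mul_left _ hU)).mul
        ((isGateProduct_controlled_circuit V).mono (Nat.mul_le_mul_left _ hV))
  have hH : IsGateProduct 1 (onControl (Q := Q) hadamard) :=
    isGateProduct_onControl hadamard_mem_unitaryGroup
  obtain ⟨T, hdepth, hT⟩ := (((hH.mul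
    (isGateProduct_onControl (phase_mem_unitaryGroup im))).mul hUV).mul hH).exists_circuit
  exact ⟨T, hT, hdepth.trans (by nlinarith [Nat.zero_le (Fintype.card Q), Nat.zero_le d])⟩

end ControlledGate

/-! ### The outcome of the Hadamard test -/

section Outcome

variable {Q : Type} [Fintype Q] [DecidableEq Q]

lemma sum_option_pi {R : Type*} [AddCommMonoid R] (f : (Option Q → Bool) → R) :
    ∑ x, f x = ∑ b : Bool, ∑ z : Q → Bool, f (fun o => o.elim b z) := by
  rw [← Fintype.sum_prod_type', ← (Equiv.piOptionEquivProd (β := fun _ => Bool)).symm.sum_comp]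
  refine Finset.sum_congr rfl fun p _ => congrArg f ?_
  funext o
  cases o <;> rfl

lemma onControl_mul_apply (h : Matrix Bool Bool ℂ)
    (X : Matrix (Option Q → Bool) (Option Q → Bool) ℂ) (x y : Option Q → Bool) :
    (onControl (Q := Q) h * X) x y =
      ∑ b, h (x none) b * X (fun o => o.elim b (fun q => x (some q))) y := by
  simp only [Matrix.mul_apply, sum_option_pi, onControl, Option.elim_none, Option.elim_some,
    ite_mul, zero_mul]
  refine Finset.sum_congr rfl fun b _ => ?_
  exact (Fintype.sum_eq_single (fun q => x (some q)) fun z hz =>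
    if_neg fun h => hz (funext h).symm).trans (if_pos fun _ => rfl)

lemma mul_onControl_apply (h : Matrix Bool Bool ℂ)
    (X : Matrix (Option Q → Bool) (Option Q → Bool) ℂ) (x y : Option Q → Bool) :
    (X * onControl (Q := Q) h) x y =
      ∑ b, X x (fun o => o.elim b (fun q => y (some q))) * h b (y none) := by
  simp only [Matrix.mul_apply, sum_option_pi, onControl, Option.elim_none, Option.elim_some,
    mul_ite, mul_zero]
  refine Finset.sum_congr rfl fun b _ => ?_
  exact (Fintype.sum_eq_single (fun q => y (some q)) fun z hz =>
    if_neg fun h => hz (funext h)).trans (if_pos fun _ => rfl)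

lemma controlled_elim_apply (U : Matrix (Q → Bool) (Q → Bool) ℂ) (b b' : Bool) (z z' : Q → Bool) :
    controlled U (fun o => o.elim b z) (fun o => o.elim b' z') =
      if b = b' then (bif b then U else 1) z z' else 0 := by
  rw [controlled_eq_selectOp, selectOp_apply]
  rfl

/-- The value `1` of the outcome `0` and the value `-1` of the outcome `1`. -/
def outcomeSign (b : Bool) : ℝ := if b = false then 1 else -1

/-- The part of a complex number that the Hadamard test with parameter `im` estimates: the
imaginary part for `im = true`, the real part for `im = false`. -/
def partOf (im : Bool) (w : ℂ) : ℝ := if im = true then w.im else w.re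

/-- The entry of `phase im` on which the control qubit is `1`: the real part of its product with
`w` is `partOf im w`. -/
def phaseFactor (im : Bool) : ℂ := if im = true then -Complex.I else 1

lemma IsHadamardTest.state_eq {T : Circuit (Option Q)} {im : Bool}
    {U : Matrix (Q → Bool) (Q → Bool) ℂ} (hT : IsHadamardTest T im U) (b : Bool) (z : Q → Bool) :
    T.state (fun o => o.elim b z) = 1 / 2 *
      ((1 : Matrix (Q → Bool) (Q → Bool) ℂ) z (zeroState Q)
        + outcomeSign b * phaseFactor im * U z (zeroState Q)) := by
  have hsqrt : ((√2 : ℝ) : ℂ)⁻¹ * ((√2 : ℝ) : ℂ)⁻¹ = 1 / 2 := by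
    rw [← mul_inv, ← Complex.ofReal_mul, Real.mul_self_sqrt zero_le_two]
    norm_num
  have hzero : zeroState (Option Q) = fun o => o.elim false (zeroState Q) := by
    funext o
    cases o <;> rfl
  rw [Circuit.state, hT, hzero]
  simp only [mul_assoc, onControl_mul_apply, mul_onControl_apply, Option.elim_none,
    Option.elim_some, controlled_elim_apply, phase, diagonal_apply, hadamard, Fintype.sum_bool]
  set u := U z (zeroState Q)
  set δ := (1 : Matrix (Q → Bool) (Q → Bool) ℂ) z (zeroState Q)
  cases b <;> cases im <;> simp only [outcomeSign, phaseFactor] <;> norm_num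
  · linear_combination (δ + u) * hsqrt
  · linear_combination (δ - Complex.I * u) * hsqrt
  · linear_combination (δ - u) * hsqrt
  · linear_combination (δ + Complex.I * u) * hsqrt

lemma norm_add_mul_sq_of_norm_eq_one {w : ℂ} (hw : ‖w‖ = 1) (p u : ℂ) :
    ‖p + w * u‖ ^ 2 = ‖p‖ ^ 2 + ‖u‖ ^ 2 + 2 * (w * u * star p).re := by
  have hwu : ‖w * u‖ = ‖u‖ := by rw [norm_mul, hw, one_mul]
  rw [← hwu, add_comm p, Complex.sq_norm, Complex.sq_norm, Complex.sq_norm, Complex.normSq_add,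
    add_comm (Complex.normSq p)]
  rfl

lemma sum_norm_sq_column {n : Type*} [Fintype n] [DecidableEq n] {U : Matrix n n ℂ}
    (hU : U ∈ unitaryGroup n ℂ) (y : n) : ∑ z, ‖U z y‖ ^ 2 = 1 := by
  have h := congrFun (congrFun (mem_unitaryGroup_iff'.1 hU) y) y
  simp only [Matrix.mul_apply, star_apply, RCLike.star_def, Complex.conj_mul', one_apply_eq] at h
  exact_mod_cast h

lemma IsHadamardTest.outcomeProb_eq {T : Circuit (Option Q)} {im : Bool}
    {U : Matrix (Q → Bool) (Q → Bool) ℂ} (hT : IsHadamardTest T im U)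
    (hU : U ∈ unitaryGroup (Q → Bool) ℂ) (v : Bool) :
    T.outcomeProb none v =
      (1 + outcomeSign v * partOf im (U (zeroState Q) (zeroState Q))) / 2 := by
  set w : ℂ := outcomeSign v * phaseFactor im with hw
  have hw1 : ‖w‖ = 1 := by cases v <;> cases im <;> simp [w, outcomeSign, phaseFactor]
  have hcross : ∑ z, (w * U z (zeroState Q) *
      star ((1 : Matrix (Q → Bool) (Q → Bool) ℂ) z (zeroState Q))).re
      = outcomeSign v * partOf im (U (zeroState Q) (zeroState Q)) := by
    rw [Fintype.sum_eq_single (zeroState Q) fun z hz => by rw [one_apply_ne hz]; simp]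
    cases im <;> simp [w, phaseFactor, partOf, mul_assoc]
  have hprob : T.outcomeProb none v = ∑ z : Q → Bool, ‖T.state (fun o => o.elim v z)‖ ^ 2 := by
    rw [Circuit.outcomeProb, sum_option_pi]
    cases v <;> simp
  simp only [hprob, hT.state_eq, ← hw, norm_mul, mul_pow, norm_add_mul_sq_of_norm_eq_one hw1]
  rw [← Finset.mul_sum, Finset.sum_add_distrib, Finset.sum_add_distrib, ← Finset.mul_sum, hcross,
    sum_norm_sq_column hU, sum_norm_sq_column (one_mem _)]
  norm_num
  ring

lemma Circuit.outcomeProb_nonneg (T : Circuit Q) (q : Q) (v : Bool) : 0 ≤ T.outcomeProb q v :=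
  Finset.sum_nonneg fun x _ => by split_ifs <;> positivity

lemma IsHadamardTest.isProbabilityMeasure {T : Circuit (Option Q)} {im : Bool}
    {U : Matrix (Q → Bool) (Q → Bool) ℂ} (hT : IsHadamardTest T im U)
    (hU : U ∈ unitaryGroup (Q → Bool) ℂ) :
    MeasureTheory.IsProbabilityMeasure (T.outcomeLaw none) := by
  constructor
  simp only [Circuit.outcomeLaw, Fintype.sum_bool, MeasureTheory.Measure.add_apply,
    MeasureTheory.Measure.smul_apply, MeasureTheory.measure_univ, smul_eq_mul, mul_one]
  rw [← ENNReal.ofReal_add (T.outcomeProb_nonneg _ _) (T.outcomeProb_nonneg _ _),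
    ENNReal.ofReal_eq_one, hT.outcomeProb_eq hU, hT.outcomeProb_eq hU]
  norm_num [outcomeSign]
  ring

lemma IsHadamardTest.integral_outcomeSign {T : Circuit (Option Q)} {im : Bool}
    {U : Matrix (Q → Bool) (Q → Bool) ℂ} (hT : IsHadamardTest T im U)
    (hU : U ∈ unitaryGroup (Q → Bool) ℂ) :
    ∫ b, outcomeSign b ∂(T.outcomeLaw none) = partOf im (U (zeroState Q) (zeroState Q)) := by
  rw [Circuit.outcomeLaw, MeasureTheory.integral_finsetSum_measure fun v _ =>
    (MeasureTheory.integrable_dirac (by simp)).smul_measure ENNReal.ofReal_ne_top]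
  simp only [MeasureTheory.integral_smul_measure, MeasureTheory.integral_dirac, Fintype.sum_bool]
  rw [ENNReal.toReal_ofReal (T.outcomeProb_nonneg _ _),
    ENNReal.toReal_ofReal (T.outcomeProb_nonneg _ _), hT.outcomeProb_eq hU, hT.outcomeProb_eq hU]
  norm_num [outcomeSign]
  ring

end Outcome

/-! ### Euclidean and spectral norms -/

section Norms

variable {m : Type} [Fintype m]

lemma l2norm_nonneg (v : m → ℂ) : 0 ≤ l2norm v := norm_nonneg _

lemma l2norm_zero : l2norm (0 : m → ℂ) = 0 := norm_zero

lemma l2norm_pos {v : m → ℂ} (h : v ≠ 0) : 0 < l2norm v :=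
  norm_pos_iff.2 ((WithLp.toLp_eq_zero 2).not.2 h)

lemma l2norm_add_le (v w : m → ℂ) : l2norm (v + w) ≤ l2norm v + l2norm w :=
  norm_add_le (WithLp.toLp 2 v) (WithLp.toLp 2 w)

lemma l2norm_sub_le (v w : m → ℂ) : l2norm (v - w) ≤ l2norm v + l2norm w :=
  norm_sub_le (WithLp.toLp 2 v) (WithLp.toLp 2 w)

lemma l2norm_smul (r : ℂ) (v : m → ℂ) : l2norm (r • v) = ‖r‖ * l2norm v :=
  norm_smul r (WithLp.toLp 2 v)

lemma l2norm_neg (v : m → ℂ) : l2norm (-v) = l2norm v := norm_neg (WithLp.toLp 2 v)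

lemma l2norm_sq (v : m → ℂ) : l2norm v ^ 2 = ∑ i, ‖v i‖ ^ 2 :=
  EuclideanSpace.norm_sq_eq (WithLp.toLp 2 v)

lemma star_dotProduct_self_re (v : m → ℂ) : (star v ⬝ᵥ v).re = l2norm v ^ 2 := by
  simp only [l2norm_sq, dotProduct, Complex.re_sum, Pi.star_apply, RCLike.star_def,
    Complex.conj_mul']
  norm_cast

lemma l2norm_add_sq (v w : m → ℂ) :
    l2norm (v + w) ^ 2 = l2norm v ^ 2 + 2 * (star v ⬝ᵥ w).re + l2norm w ^ 2 := by
  have h := norm_add_sq (𝕜 := ℂ) (WithLp.toLp 2 v) (WithLp.toLp 2 w)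
  rwa [EuclideanSpace.inner_toLp_toLp, dotProduct_comm] at h

variable {n : Type} [Fintype n] [DecidableEq n]

lemma specNorm_eq_norm (A : Matrix m n ℂ) : specNorm A = ‖A‖ := rfl

lemma l2norm_mulVec_le (A : Matrix m n ℂ) (v : n → ℂ) : l2norm (A *ᵥ v) ≤ ‖A‖ * l2norm v :=
  l2_opNorm_mulVec A (WithLp.toLp 2 v)

end Norms

/-! ### The Moore-Penrose equations -/

section Penrose

variable {m n : Type} [Fintype m] [Fintype n] [DecidableEq n] (A : Matrix m n ℂ)

lemma exists_pinv_eq_mul_conjTranspose :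
    ∃ P : Matrix n n ℂ, pinv A = P * Aᴴ ∧ Pᴴ = P ∧ Aᴴ * A * P = P * (Aᴴ * A) ∧
      Aᴴ * A * P * (Aᴴ * A) = Aᴴ * A ∧ P * (Aᴴ * A) * P = P := by
  set h := isHermitian_conjTranspose_mul_self A
  set φ := Unitary.conjStarAlgAut ℂ (Matrix n n ℂ) h.eigenvectorUnitary
  set D : Matrix n n ℂ := diagonal fun i => (h.eigenvalues i : ℂ)
  set D' : Matrix n n ℂ := diagonal fun i => (((h.eigenvalues i)⁻¹ : ℝ) : ℂ)
  have hG : Aᴴ * A = φ D := h.spectral_theorem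
  have hD' : star D' = D' := by
    simp only [D', star_eq_conjTranspose, diagonal_conjTranspose]
    congr with i
    exact Complex.conj_ofReal _
  refine ⟨φ D', rfl, (map_star φ D').symm.trans (congrArg φ hD'), ?_, ?_, ?_⟩ <;>
    rw [hG] <;> simp only [← map_mul, D, D', diagonal_mul_diagonal] <;> congr with i
  · exact mul_comm _ _
  · rw [Complex.ofReal_inv, mul_inv_mul_cancel]
  · simpa using mul_inv_mul_cancel (h.eigenvalues i : ℂ)⁻¹

lemma conjTranspose_pinv_mul_self : (pinv A * A)ᴴ = pinv A * A := by
  obtain ⟨P, hpinv, hP, hcomm, -, -⟩ := exists_pinv_eq_mul_conjTranspose A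
  rw [hpinv, Matrix.mul_assoc, conjTranspose_mul, hP, conjTranspose_mul,
    conjTranspose_conjTranspose, hcomm]

lemma conjTranspose_mul_pinv_self : (A * pinv A)ᴴ = A * pinv A := by
  obtain ⟨P, hpinv, hP, -, -, -⟩ := exists_pinv_eq_mul_conjTranspose A
  simp only [hpinv, conjTranspose_mul, conjTranspose_conjTranspose, hP, Matrix.mul_assoc]

lemma pinv_mul_self_mul_pinv : pinv A * A * pinv A = pinv A := by
  obtain ⟨P, hpinv, -, -, -, hPGP⟩ := exists_pinv_eq_mul_conjTranspose A
  rw [hpinv, ← Matrix.mul_assoc, Matrix.mul_assoc P, hPGP]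

open scoped ComplexOrder in
lemma mul_pinv_mul_self : A * pinv A * A = A := by
  obtain ⟨P, hpinv, -, -, hGPG, -⟩ := exists_pinv_eq_mul_conjTranspose A
  have hzero : Aᴴ * A * (P * (Aᴴ * A) - 1) = 0 := by
    rw [Matrix.mul_sub, ← Matrix.mul_assoc, hGPG, Matrix.mul_one, sub_self]
  rw [conjTranspose_mul_self_mul_eq_zero, Matrix.mul_sub, Matrix.mul_one, sub_eq_zero] at hzero
  rw [hpinv, Matrix.mul_assoc, Matrix.mul_assoc P, hzero]

lemma pinv_ne_zero {A : Matrix m n ℂ} (hA : A ≠ 0) : pinv A ≠ 0 := by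
  rintro h
  exact hA (by rw [← mul_pinv_mul_self A, h, Matrix.mul_zero, Matrix.zero_mul])

lemma one_le_norm_mul_norm_pinv [DecidableEq m] {A : Matrix m n ℂ} (hA : A ≠ 0) :
    1 ≤ ‖A‖ * ‖pinv A‖ := by
  refine le_of_mul_le_mul_right ?_ (norm_pos_iff.2 hA)
  calc 1 * ‖A‖ = ‖A * pinv A * A‖ := by rw [mul_pinv_mul_self, one_mul]
    _ ≤ ‖A * pinv A‖ * ‖A‖ := l2_opNorm_mul _ _
    _ ≤ ‖A‖ * ‖pinv A‖ * ‖A‖ := by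
      gcongr
      exact l2_opNorm_mul _ _

lemma gram_mul_pinv_mul_conjTranspose_pinv :
    Aᴴ * A * (pinv A * (pinv A)ᴴ) = pinv A * A :=
  calc Aᴴ * A * (pinv A * (pinv A)ᴴ) = Aᴴ * (A * pinv A) * (pinv A)ᴴ := by
        simp only [Matrix.mul_assoc]
    _ = (pinv A * (A * pinv A) * A)ᴴ := by
        rw [conjTranspose_mul, conjTranspose_mul (pinv A), conjTranspose_mul_pinv_self A,
          Matrix.mul_assoc Aᴴ]
    _ = pinv A * A := by
        rw [← Matrix.mul_assoc, pinv_mul_self_mul_pinv, conjTranspose_pinv_mul_self]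

lemma isStarProjection_pinv_mul_self : IsStarProjection (pinv A * A) :=
  ⟨by rw [IsIdempotentElem, ← Matrix.mul_assoc, pinv_mul_self_mul_pinv],
    conjTranspose_pinv_mul_self A⟩

lemma mul_mul_pinv_of_isHermitian {V : Matrix n n ℂ} (hV : V.IsHermitian) :
    V * (V * pinv V) = V := by
  have h := congrArg conjTranspose (mul_pinv_mul_self V)
  rwa [conjTranspose_mul, conjTranspose_mul_pinv_self, hV] at h

lemma pinv_mul_self_of_linearIndependent {A : Matrix m n ℂ} (h : LinearIndependent ℂ Aᵀ) :
    pinv A * A = 1 := by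
  refine ext_of_mulVec_single fun j => mulVec_injective_iff.2 h ?_
  rw [one_mulVec, mulVec_mulVec, ← Matrix.mul_assoc, mul_pinv_mul_self]

end Penrose

/-! ### Perturbation of the shifted system -/

section Perturbation

variable {ι : Type} [Fintype ι] [DecidableEq ι]

/-- The matrix `V² + r` of the shifted system, so that `QHat = shiftedSq VHat`. -/
def shiftedSq (V : Matrix ι ι ℂ) (r : ℝ) : Matrix ι ι ℂ := V ^ 2 + (r : ℂ) • 1

/-- The solution `(V² + r)⁻¹ V c` of the shifted system, so that `alphaHat` is the solution for
`V = VHat`. It is junk when `V² + r` is singular. -/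
def shiftedSolution (V : Matrix ι ι ℂ) (r : ℝ) (c : ι → ℂ) : ι → ℂ :=
  (shiftedSq V r)⁻¹ *ᵥ (V *ᵥ c)

lemma l2norm_shiftedSq_mulVec_sq {V : Matrix ι ι ℂ} (hV : V.IsHermitian) (r : ℝ) (v : ι → ℂ) :
    l2norm (shiftedSq V r *ᵥ v) ^ 2 =
      l2norm ((V ^ 2) *ᵥ v) ^ 2 + 2 * r * l2norm (V *ᵥ v) ^ 2 + r ^ 2 * l2norm v ^ 2 := by
  have hadj : star ((V ^ 2) *ᵥ v) ⬝ᵥ v = star (V *ᵥ v) ⬝ᵥ (V *ᵥ v) := by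
    rw [pow_two, ← mulVec_mulVec, star_mulVec, ← dotProduct_mulVec, hV]
  rw [shiftedSq, add_mulVec, l2norm_add_sq, smul_mulVec, one_mulVec, l2norm_smul, dotProduct_smul,
    hadj, smul_eq_mul, Complex.re_ofReal_mul, star_dotProduct_self_re, mul_pow, Complex.norm_real,
    Real.norm_eq_abs, sq_abs]
  ring

variable {V : Matrix ι ι ℂ} {r : ℝ}

lemma mul_l2norm_le_l2norm_shiftedSq_mulVec (hV : V.IsHermitian) (hr : 0 ≤ r) (v : ι → ℂ) :
    r * l2norm v ≤ l2norm (shiftedSq V r *ᵥ v) := by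
  refine le_of_sq_le_sq ?_ (l2norm_nonneg _)
  rw [l2norm_shiftedSq_mulVec_sq hV, mul_pow]
  have := mul_nonneg hr (sq_nonneg (l2norm (V *ᵥ v)))
  linarith [sq_nonneg (l2norm ((V ^ 2) *ᵥ v))]

lemma l2norm_sq_mulVec_le_l2norm_shiftedSq_mulVec (hV : V.IsHermitian) (hr : 0 ≤ r) (v : ι → ℂ) :
    l2norm ((V ^ 2) *ᵥ v) ≤ l2norm (shiftedSq V r *ᵥ v) := by
  refine le_of_sq_le_sq ?_ (l2norm_nonneg _)
  rw [l2norm_shiftedSq_mulVec_sq hV]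
  have := mul_nonneg hr (sq_nonneg (l2norm (V *ᵥ v)))
  linarith [mul_nonneg (sq_nonneg r) (sq_nonneg (l2norm v))]

lemma isUnit_det_of_forall_mul_l2norm_le {X : Matrix ι ι ℂ} (hr : 0 < r)
    (h : ∀ v, r * l2norm v ≤ l2norm (X *ᵥ v)) : IsUnit X.det := by
  rw [isUnit_iff_ne_zero]
  intro hdet
  obtain ⟨v, hv, hXv⟩ := exists_mulVec_eq_zero_iff.2 hdet
  have hle := h v
  rw [hXv, l2norm_zero] at hle
  exact (mul_pos hr (l2norm_pos hv)).not_ge hle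

lemma isUnit_det_shiftedSq (hV : V.IsHermitian) (hr : 0 < r) : IsUnit (shiftedSq V r).det :=
  isUnit_det_of_forall_mul_l2norm_le hr (mul_l2norm_le_l2norm_shiftedSq_mulVec hV hr.le)

lemma commute_inv_shiftedSq (hV : V.IsHermitian) (hr : 0 < r) : Commute V (shiftedSq V r)⁻¹ := by
  let _ := invertibleOfIsUnitDet _ (isUnit_det_shiftedSq hV hr)
  have h : Commute V (shiftedSq V r) :=
    ((Commute.refl V).pow_right 2).add_right ((Commute.one_right V).smul_right _)
  rw [← invOf_eq_nonsing_inv]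
  exact h.invOf_right

lemma shiftedSq_mulVec_shiftedSolution (h : IsUnit (shiftedSq V r).det) (c : ι → ℂ) :
    shiftedSq V r *ᵥ shiftedSolution V r c = V *ᵥ c := by
  rw [shiftedSolution, mulVec_mulVec, mul_nonsing_inv _ h, one_mulVec]

lemma l2norm_sq_mul_inv_shiftedSq_mulVec_le (hV : V.IsHermitian) (hr : 0 < r) (w : ι → ℂ) :
    l2norm ((V ^ 2 * (shiftedSq V r)⁻¹) *ᵥ w) ≤ l2norm w := by
  have h := l2norm_sq_mulVec_le_l2norm_shiftedSq_mulVec hV hr.le ((shiftedSq V r)⁻¹ *ᵥ w)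
  rwa [mulVec_mulVec, mulVec_mulVec, mul_nonsing_inv _ (isUnit_det_shiftedSq hV hr),
    one_mulVec] at h

lemma l2norm_shiftedSolution_le (hV : V.IsHermitian) (hr : 0 < r) {c α : ι → ℂ}
    (hα : V *ᵥ c = (V ^ 2) *ᵥ α) : l2norm (shiftedSolution V r c) ≤ l2norm α := by
  rw [shiftedSolution, hα, mulVec_mulVec, ← ((commute_inv_shiftedSq hV hr).pow_left 2).eq]
  exact l2norm_sq_mul_inv_shiftedSq_mulVec_le hV hr α

lemma norm_shiftedSq_sub_le (V V' : Matrix ι ι ℂ) (r : ℝ) :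
    ‖shiftedSq V' r - shiftedSq V r‖ ≤ (2 * ‖V‖ + ‖V' - V‖) * ‖V' - V‖ := by
  set E := V' - V with hE
  have hexpand : shiftedSq V' r - shiftedSq V r = V * E + E * V + E * E := by
    rw [shiftedSq, shiftedSq, hE]
    noncomm_ring
  calc ‖shiftedSq V' r - shiftedSq V r‖ ≤ ‖V * E‖ + ‖E * V‖ + ‖E * E‖ :=
        hexpand ▸ norm_add₃_le
    _ ≤ ‖V‖ * ‖E‖ + ‖E‖ * ‖V‖ + ‖E‖ * ‖E‖ := by gcongr <;> exact l2_opNorm_mul _ _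
    _ = (2 * ‖V‖ + ‖E‖) * ‖E‖ := by ring

variable {V' : Matrix ι ι ℂ}

lemma half_mul_l2norm_le_of_norm_shiftedSq_sub_le (hV : V.IsHermitian) (hr : 0 ≤ r)
    (hdiff : ‖shiftedSq V' r - shiftedSq V r‖ ≤ r / 2) (v : ι → ℂ) :
    r / 2 * l2norm v ≤ l2norm (shiftedSq V' r *ᵥ v) := by
  have hsplit : shiftedSq V r *ᵥ v
      = shiftedSq V' r *ᵥ v - (shiftedSq V' r - shiftedSq V r) *ᵥ v := by
    rw [sub_mulVec, sub_sub_cancel]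
  have hlower := mul_l2norm_le_l2norm_shiftedSq_mulVec hV hr v
  have htriangle := l2norm_sub_le (shiftedSq V' r *ᵥ v) ((shiftedSq V' r - shiftedSq V r) *ᵥ v)
  have hpert := (l2norm_mulVec_le (shiftedSq V' r - shiftedSq V r) v).trans
    (mul_le_mul_of_nonneg_right hdiff (l2norm_nonneg v))
  rw [← hsplit] at htriangle
  linarith

lemma isUnit_det_shiftedSq_of_norm_sub_le (hV : V.IsHermitian) (hr : 0 < r)
    (hdiff : ‖shiftedSq V' r - shiftedSq V r‖ ≤ r / 2) : IsUnit (shiftedSq V' r).det :=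
  isUnit_det_of_forall_mul_l2norm_le (half_pos hr)
    (half_mul_l2norm_le_of_norm_shiftedSq_sub_le hV hr.le hdiff)

lemma half_mul_l2norm_shiftedSolution_sub_le (hV : V.IsHermitian) (hr : 0 < r)
    (hdiff : ‖shiftedSq V' r - shiftedSq V r‖ ≤ r / 2) {c α : ι → ℂ}
    (hα : V *ᵥ c = (V ^ 2) *ᵥ α) :
    r / 2 * l2norm (shiftedSolution V' r c - shiftedSolution V r c) ≤
      ‖V' - V‖ * l2norm c + ‖shiftedSq V' r - shiftedSq V r‖ * l2norm α := by
  have hresidual : shiftedSq V' r *ᵥ (shiftedSolution V' r c - shiftedSolution V r c)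
      = (V' - V) *ᵥ c - (shiftedSq V' r - shiftedSq V r) *ᵥ shiftedSolution V r c := by
    rw [mulVec_sub, sub_mulVec, sub_mulVec,
      shiftedSq_mulVec_shiftedSolution (isUnit_det_shiftedSq_of_norm_sub_le hV hr hdiff),
      shiftedSq_mulVec_shiftedSolution (isUnit_det_shiftedSq hV hr)]
    abel
  refine (half_mul_l2norm_le_of_norm_shiftedSq_sub_le hV hr.le hdiff _).trans ?_
  rw [hresidual]
  refine (l2norm_sub_le _ _).trans (add_le_add (l2norm_mulVec_le _ _) ?_)
  exact (l2norm_mulVec_le _ _).trans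
    (mul_le_mul_of_nonneg_left (l2norm_shiftedSolution_le hV hr hα) (norm_nonneg _))

lemma isUnit_det_and_l2norm_mulVec_shiftedSolution_sub_le (hV : V.IsHermitian) {c α : ι → ℂ}
    (hα : V *ᵥ c = (V ^ 2) *ᵥ α) {b η ε : ℝ} (hb : ‖V‖ ≤ b) (hr : 0 < r) (hε : 0 < ε)
    (hE : ‖V' - V‖ ≤ η) (hηb : η ≤ 19 * b)
    (hη : b * η * (b * l2norm α + ε + l2norm c) ≤ r * ε / 84) :
    IsUnit (shiftedSq V' r).det ∧
      l2norm (V *ᵥ (shiftedSolution V' r c - shiftedSolution V r c)) ≤ ε / 2 := by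
  have hb0 : 0 ≤ b := (norm_nonneg V).trans hb
  have hη0 : 0 ≤ η := (norm_nonneg _).trans hE
  have hα0 := l2norm_nonneg α
  have hc0 := l2norm_nonneg c
  have hbη0 : 0 ≤ b * η := mul_nonneg hb0 hη0
  have hdiff : ‖shiftedSq V' r - shiftedSq V r‖ ≤ 21 * (b * η) :=
    calc ‖shiftedSq V' r - shiftedSq V r‖ ≤ (2 * ‖V‖ + ‖V' - V‖) * ‖V' - V‖ :=
          norm_shiftedSq_sub_le V V' r
      _ ≤ (2 * b + 19 * b) * η := by gcongr; exact hE.trans hηb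
      _ = 21 * (b * η) := by ring
  have hbη : b * η ≤ r / 84 := by
    refine le_of_mul_le_mul_right (le_trans ?_ hη |>.trans_eq (by ring)) hε
    exact mul_le_mul_of_nonneg_left (by nlinarith [mul_nonneg hb0 hα0]) hbη0
  have hhalf : ‖shiftedSq V' r - shiftedSq V r‖ ≤ r / 2 := by linarith
  refine ⟨isUnit_det_shiftedSq_of_norm_sub_le hV hr hhalf, ?_⟩
  set x := l2norm (shiftedSolution V' r c - shiftedSolution V r c)
  have hx : r / 2 * x ≤ η * l2norm c + 21 * (b * η) * l2norm α :=
    (half_mul_l2norm_shiftedSolution_sub_le hV hr hhalf hα).trans (by gcongr)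
  have hbx : r / 2 * (b * x) ≤ r / 2 * (ε / 2) := by
    calc r / 2 * (b * x) = b * (r / 2 * x) := by ring
      _ ≤ b * (η * l2norm c + 21 * (b * η) * l2norm α) := by gcongr
      _ ≤ 21 * (b * η * (b * l2norm α + ε + l2norm c)) := by
          nlinarith [mul_nonneg hbη0 hc0, mul_nonneg hbη0 hε.le]
      _ ≤ 21 * (r * ε / 84) := by gcongr
      _ = r / 2 * (ε / 2) := by ring
  calc l2norm (V *ᵥ (shiftedSolution V' r c - shiftedSolution V r c)) ≤ ‖V‖ * x :=
        l2norm_mulVec_le _ _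
    _ ≤ b * x := mul_le_mul_of_nonneg_right hb (l2norm_nonneg _)
    _ ≤ ε / 2 := le_of_mul_le_mul_left hbx (half_pos hr)

end Perturbation

section Accuracy

variable {m ι : Type} [Fintype m] [Fintype ι] [DecidableEq ι]

lemma gram_mul_inv_shiftedSq_mul_gram_sub (A : Matrix m ι ℂ) {r : ℝ} (hr : 0 < r) :
    Aᴴ * A * (shiftedSq (Aᴴ * A) r)⁻¹ * (Aᴴ * A) - pinv A * A =
      -((r : ℂ) • ((Aᴴ * A) ^ 2 * (shiftedSq (Aᴴ * A) r)⁻¹ *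
        (pinv A * (pinv A)ᴴ * (pinv A * (pinv A)ᴴ)))) := by
  have hV : (Aᴴ * A).IsHermitian := isHermitian_conjTranspose_mul_self A
  have hunit := isUnit_det_shiftedSq hV hr
  have hcomm := commute_inv_shiftedSq hV hr
  have hVB : Aᴴ * A * (pinv A * (pinv A)ᴴ) = pinv A * A :=
    gram_mul_pinv_mul_conjTranspose_pinv A
  have hVP : Aᴴ * A * (pinv A * A) = Aᴴ * A := by
    rw [Matrix.mul_assoc, ← Matrix.mul_assoc A, mul_pinv_mul_self]
  set V := Aᴴ * A
  set P := pinv A * A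
  set B := pinv A * (pinv A)ᴴ
  set R := (shiftedSq V r)⁻¹ with hR
  have hVVBB : V ^ 2 * (B * B) = P :=
    calc V ^ 2 * (B * B) = V * (V * B) * B := by noncomm_ring
      _ = P := by rw [hVB, hVP, hVB]
  have hVVP : V ^ 2 * P = V ^ 2 := by rw [pow_two, Matrix.mul_assoc, hVP]
  calc V * R * V - P = R * (V ^ 2 * P) - R * (shiftedSq V r * P) := by
        rw [hVVP, hcomm.eq, ← Matrix.mul_assoc R (shiftedSq V r), hR, nonsing_inv_mul _ hunit,
          Matrix.one_mul, pow_two, Matrix.mul_assoc]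
    _ = -((r : ℂ) • (R * P)) := by
        rw [← Matrix.mul_sub, ← Matrix.sub_mul, shiftedSq, sub_add_cancel_left, Matrix.neg_mul,
          Matrix.mul_neg, smul_mul_assoc, Matrix.one_mul, mul_smul_comm]
    _ = -((r : ℂ) • (V ^ 2 * R * (B * B))) := by
        rw [← hVVBB, ← Matrix.mul_assoc, (hcomm.pow_left 2).eq]

lemma l2norm_gram_mulVec_shiftedSolution_sub_le [DecidableEq m] (A : Matrix m ι ℂ) (c : ι → ℂ)
    {r : ℝ} (hr : 0 < r) :
    l2norm ((Aᴴ * A) *ᵥ shiftedSolution (Aᴴ * A) r c - (pinv A * A) *ᵥ c) ≤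
      r * ‖pinv A‖ ^ 4 * l2norm c := by
  set B := pinv A * (pinv A)ᴴ
  have hBB : ‖B * B‖ ≤ ‖pinv A‖ ^ 4 :=
    calc ‖B * B‖ ≤ ‖B‖ * ‖B‖ := l2_opNorm_mul _ _
      _ ≤ (‖pinv A‖ * ‖(pinv A)ᴴ‖) * (‖pinv A‖ * ‖(pinv A)ᴴ‖) := by
          gcongr <;> exact l2_opNorm_mul _ _
      _ = ‖pinv A‖ ^ 4 := by rw [l2_opNorm_conjTranspose]; ring
  rw [shiftedSolution, mulVec_mulVec, mulVec_mulVec, ← sub_mulVec,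
    gram_mul_inv_shiftedSq_mul_gram_sub A hr, neg_mulVec, l2norm_neg, smul_mulVec, l2norm_smul,
    Complex.norm_real, Real.norm_of_nonneg hr.le, ← mulVec_mulVec, mul_assoc]
  refine mul_le_mul_of_nonneg_left ?_ hr.le
  calc l2norm (((Aᴴ * A) ^ 2 * (shiftedSq (Aᴴ * A) r)⁻¹) *ᵥ (B * B) *ᵥ c)
      ≤ l2norm ((B * B) *ᵥ c) :=
        l2norm_sq_mul_inv_shiftedSq_mulVec_le (isHermitian_conjTranspose_mul_self A) hr _
    _ ≤ ‖pinv A‖ ^ 4 * l2norm c :=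
        (l2norm_mulVec_le _ _).trans (mul_le_mul_of_nonneg_right hBB (l2norm_nonneg c))

lemma l2norm_pinv_mul_self_mulVec_sub_le (A : Matrix m ι ℂ) (c : ι → ℂ) :
    l2norm ((pinv A * A) *ᵥ c - c) ≤ ⨅ z : m → ℂ, l2norm (Aᴴ *ᵥ z - c) := by
  refine le_ciInf fun z => ?_
  have hPA : pinv A * A * Aᴴ = Aᴴ := by
    have h := congrArg conjTranspose (mul_pinv_mul_self A)
    rwa [Matrix.mul_assoc, conjTranspose_mul, conjTranspose_pinv_mul_self] at h
  have hproj : (pinv A * A) *ᵥ c - c = (1 - pinv A * A) *ᵥ (Aᴴ *ᵥ z - c) := by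
    rw [mulVec_sub, mulVec_mulVec, Matrix.sub_mul, hPA, Matrix.one_mul, sub_self, zero_mulVec,
      sub_mulVec, one_mulVec, zero_sub, neg_sub]
  rw [hproj]
  exact (l2norm_mulVec_le _ _).trans (mul_le_of_le_one_left (l2norm_nonneg _)
    (isStarProjection_pinv_mul_self A).one_sub.norm_le)

variable {M : ℕ} {A : Matrix m (Fin M) ℂ} {c : Fin M → ℂ} {ε : ℝ}

lemma isApproxSolution_mulVec_of_le {α : Fin M → ℂ} {r : ℝ}
    (hvar : l2norm ((Aᴴ * A) *ᵥ (α - shiftedSolution (Aᴴ * A) r c)) ≤ ε / 2)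
    (hbias : l2norm ((Aᴴ * A) *ᵥ shiftedSolution (Aᴴ * A) r c - (pinv A * A) *ᵥ c) ≤ ε / 2) :
    IsApproxSolution A c ε (A *ᵥ α) := by
  set α₀ := shiftedSolution (Aᴴ * A) r c
  have hsplit : Aᴴ *ᵥ (A *ᵥ α) - c = ((Aᴴ * A) *ᵥ (α - α₀) +
      ((Aᴴ * A) *ᵥ α₀ - (pinv A * A) *ᵥ c)) + ((pinv A * A) *ᵥ c - c) := by
    rw [mulVec_mulVec, mulVec_sub]
    abel
  have h₁ := l2norm_add_le ((Aᴴ * A) *ᵥ (α - α₀) + ((Aᴴ * A) *ᵥ α₀ - (pinv A * A) *ᵥ c))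
    ((pinv A * A) *ᵥ c - c)
  have h₂ := l2norm_add_le ((Aᴴ * A) *ᵥ (α - α₀)) ((Aᴴ * A) *ᵥ α₀ - (pinv A * A) *ᵥ c)
  have h₃ := l2norm_pinv_mul_self_mulVec_sub_le A c
  rw [IsApproxSolution, hsplit]
  linarith

variable [DecidableEq m]

lemma norm_pinv_pos (hA : A ≠ 0) : 0 < ‖pinv A‖ := norm_pos_iff.2 (pinv_ne_zero hA)

lemma shift_pos (hA : A ≠ 0) (hc : c ≠ 0) (hε : 0 < ε) : 0 < shift A c ε := by
  have := norm_pos_iff.2 hA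
  have := norm_pinv_pos hA
  have := l2norm_pos hc
  rw [shift, specNorm_eq_norm, specNorm_eq_norm]
  positivity

lemma shift_mul_eq (hA : A ≠ 0) (hc : c ≠ 0) (ε : ℝ) :
    shift A c ε * (2 * ‖pinv A‖ ^ 8 * ‖A‖ ^ 4 * l2norm c) = ε := by
  have := norm_pos_iff.2 hA
  have := norm_pinv_pos hA
  have := l2norm_pos hc
  rw [shift, specNorm_eq_norm, specNorm_eq_norm]
  exact div_mul_cancel₀ _ (by positivity)

lemma shift_mul_norm_pinv_pow_le (hA : A ≠ 0) (hc : c ≠ 0) (hε : 0 < ε) :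
    shift A c ε * ‖pinv A‖ ^ 4 * l2norm c ≤ ε / 2 := by
  have hshift := shift_pos hA hc hε
  have := l2norm_nonneg c
  calc shift A c ε * ‖pinv A‖ ^ 4 * l2norm c
      ≤ shift A c ε * ‖pinv A‖ ^ 4 * l2norm c * (‖A‖ * ‖pinv A‖) ^ 4 :=
        le_mul_of_one_le_right (by positivity) (one_le_pow₀ (one_le_norm_mul_norm_pinv hA))
    _ = shift A c ε * (2 * ‖pinv A‖ ^ 8 * ‖A‖ ^ 4 * l2norm c) / 2 := by ring
    _ = ε / 2 := by rw [shift_mul_eq hA hc]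

lemma sq_norm_mul_le_of_sq_mul_mainFactor_le (hA : A ≠ 0) (hc : c ≠ 0) (hε : 0 < ε) {η : ℝ}
    (hη : η ^ 2 * mainFactor A c ε ≤ (1 / 168) ^ 2) :
    ‖A‖ ^ 2 * η * (‖A‖ ^ 2 * l2norm (alphaStar A c) + ε + l2norm c) ≤ shift A c ε * ε / 84 := by
  have := norm_pos_iff.2 hA
  have := norm_pinv_pos hA
  have := l2norm_pos hc
  set s := ‖A‖ ^ 2 * l2norm (alphaStar A c) + ε + l2norm c with hs
  have hsq : η ^ 2 * mainFactor A c ε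
      = (η * (‖A‖ ^ 6 * ‖pinv A‖ ^ 8 * l2norm c * s / ε ^ 2)) ^ 2 := by
    rw [mainFactor, cond, specNorm_eq_norm, specNorm_eq_norm, ← hs]
    field_simp
  have hroot := (abs_le_of_sq_le_sq' (hsq ▸ hη) (by norm_num)).2
  rw [mul_div_assoc', div_le_iff₀ (by positivity)] at hroot
  refine le_of_mul_le_mul_right ?_ (show 0 < ‖pinv A‖ ^ 8 * ‖A‖ ^ 4 * l2norm c by positivity)
  calc ‖A‖ ^ 2 * η * s * (‖pinv A‖ ^ 8 * ‖A‖ ^ 4 * l2norm c)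
      = η * (‖A‖ ^ 6 * ‖pinv A‖ ^ 8 * l2norm c * s) := by ring
    _ ≤ 1 / 168 * ε * ε := hroot.trans_eq (by ring)
    _ = 1 / 168 * ε * (shift A c ε * (2 * ‖pinv A‖ ^ 8 * ‖A‖ ^ 4 * l2norm c)) := by
        rw [shift_mul_eq hA hc]
    _ = shift A c ε * ε / 84 * (‖pinv A‖ ^ 8 * ‖A‖ ^ 4 * l2norm c) := by ring

theorem isApproxSolution_shiftedSolution (hA : A ≠ 0) (hc : c ≠ 0) (hε : 0 < ε) {η : ℝ}
    {V' : Matrix (Fin M) (Fin M) ℂ} (hV' : ‖V' - Aᴴ * A‖ ≤ η) (hηA : η ≤ 19 * ‖A‖ ^ 2)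
    (hη : η ^ 2 * mainFactor A c ε ≤ (1 / 168) ^ 2) :
    IsUnit (shiftedSq V' (shift A c ε)).det ∧
      IsApproxSolution A c ε (A *ᵥ shiftedSolution V' (shift A c ε) c) := by
  have hV : (Aᴴ * A).IsHermitian := isHermitian_conjTranspose_mul_self A
  have hα : (Aᴴ * A) *ᵥ c = ((Aᴴ * A) ^ 2) *ᵥ alphaStar A c := by
    rw [alphaStar, mulVec_mulVec, pow_two, Matrix.mul_assoc, mul_mul_pinv_of_isHermitian hV]
  have hVnorm : ‖Aᴴ * A‖ ≤ ‖A‖ ^ 2 := by rw [l2_opNorm_conjTranspose_mul_self, pow_two]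
  obtain ⟨hunit, hvar⟩ := isUnit_det_and_l2norm_mulVec_shiftedSolution_sub_le hV hα hVnorm
    (shift_pos hA hc hε) hε hV' hηA (sq_norm_mul_le_of_sq_mul_mainFactor_le hA hc hε hη)
  exact ⟨hunit, isApproxSolution_mulVec_of_le hvar
    ((l2norm_gram_mulVec_shiftedSolution_sub_le A c (shift_pos hA hc hε)).trans
      (shift_mul_norm_pinv_pow_le hA hc hε))⟩

end Accuracy

/-! ### Nets and operator norms -/

section Nets

open Metric

section Covering

variable (E : Type*) [NormedAddCommGroup E] [NormedSpace ℝ E] [FiniteDimensional ℝ E]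

lemma packingNumber_closedBall_le :
    packingNumber (1 / 2) (closedBall (0 : E) 1) ≤ 5 ^ Module.finrank ℝ E := by
  refine iSup₂_le fun N hN => iSup_le fun hsep => ENat.forall_natCast_le_iff_le.1 fun k hk => ?_
  obtain ⟨t, htN, ht⟩ := Set.exists_subset_encard_eq hk
  lift t to Finset E using Set.finite_of_encard_eq_coe ht
  rw [Set.encard_coe_eq_coe_finsetCard, Nat.cast_inj] at ht
  classical
  have hcard : (t.image ((2 : ℝ) • ·)).card = k := by
    rw [Finset.card_image_of_injective _ (smul_right_injective E two_ne_zero), ht]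
  have hbound : (t.image ((2 : ℝ) • ·)).card ≤ 5 ^ Module.finrank ℝ E := by
    refine Besicovitch.card_le_of_separated _ ?_ ?_ <;>
      simp only [Finset.forall_mem_image, ← smul_sub, norm_smul, Real.norm_ofNat]
    · intro x hx
      linarith [mem_closedBall_zero_iff.1 (hN (htN hx))]
    · intro x hx y hy hxy
      have hdist : ((1 / 2 : NNReal) : ENNReal) < edist x y :=
        hsep (htN hx) (htN hy) (ne_of_apply_ne _ hxy)
      rw [edist_nndist, ENNReal.coe_lt_coe, ← NNReal.coe_lt_coe, coe_nndist, dist_eq_norm] at hdist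
      norm_num at hdist
      linarith
  rw [hcard] at hbound
  exact_mod_cast hbound

lemma exists_isCover_closedBall :
    ∃ N : Finset E, (∀ x ∈ N, ‖x‖ ≤ 1) ∧ N.card ≤ 5 ^ Module.finrank ℝ E ∧
      IsCover (1 / 2) (closedBall 0 1) (N : Set E) := by
  have hle := (coveringNumber_le_packingNumber (1 / 2) (closedBall (0 : E) 1)).trans
    (packingNumber_closedBall_le E)
  have htop : coveringNumber (1 / 2) (closedBall (0 : E) 1) ≠ ⊤ :=
    ne_top_of_le_ne_top (ENat.natCast_ne_top (5 ^ Module.finrank ℝ E)) (mod_cast hle)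
  obtain ⟨N, hN⟩ := (finite_minimalCover (ε := 1 / 2) (A := closedBall (0 : E) 1)).exists_finset_coe
  refine ⟨N, fun x hx => ?_, ?_, hN ▸ isCover_minimalCover htop⟩
  · exact mem_closedBall_zero_iff.1 (minimalCover_subset (hN ▸ Finset.mem_coe.2 hx))
  · rw [← encard_minimalCover htop, ← hN, Set.encard_coe_eq_coe_finsetCard] at hle
    exact_mod_cast hle

end Covering

variable {𝕜 E F : Type*} [RCLike 𝕜] [NormedAddCommGroup E] [NormedAddCommGroup F]
  [InnerProductSpace 𝕜 F] {t : ℝ}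

lemma exists_norm_sub_le_of_isCover {ε : NNReal} {s N : Set E} (hN : IsCover ε s N) {x : E}
    (hx : x ∈ s) : ∃ y ∈ N, ‖x - y‖ ≤ ε := by
  simpa [dist_eq_norm] using isCover_iff_subset_iUnion_closedBall.1 hN hx

lemma norm_le_two_mul_of_isCover {N : Set F} (hN : IsCover (1 / 2) (closedBall 0 1) N) (ht : 0 ≤ t)
    {w : F} (h : ∀ u ∈ N, RCLike.re (inner 𝕜 u w) ≤ t) : ‖w‖ ≤ 2 * t := by
  rcases eq_or_ne w 0 with rfl | hw
  · simpa using ht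
  set e : F := ((‖w‖⁻¹ : ℝ) : 𝕜) • w with he
  have hew : RCLike.re (inner 𝕜 e w) = ‖w‖ := by
    rw [he, inner_smul_left, RCLike.conj_ofReal, RCLike.re_ofReal_mul, inner_self_eq_norm_sq, sq,
      inv_mul_cancel_left₀ (norm_ne_zero_iff.2 hw)]
  have he_mem : e ∈ closedBall (0 : F) 1 := by
    simp [he, norm_smul, inv_mul_cancel₀ (norm_ne_zero_iff.2 hw)]
  obtain ⟨u, hu, hu_dist⟩ := exists_norm_sub_le_of_isCover hN he_mem
  have hdiff : RCLike.re (inner 𝕜 (e - u) w) ≤ 1 / 2 * ‖w‖ :=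
    (re_inner_le_norm _ _).trans (mul_le_mul_of_nonneg_right (by simpa using hu_dist)
      (norm_nonneg w))
  rw [inner_sub_left, map_sub, hew] at hdiff
  linarith [h u hu]

lemma opNorm_le_two_mul_of_isCover [NormedSpace 𝕜 E] {N : Set E}
    (hN : IsCover (1 / 2) (closedBall 0 1) N) (ht : 0 ≤ t) {T : E →L[𝕜] F}
    (h : ∀ v ∈ N, ‖T v‖ ≤ t) : ‖T‖ ≤ 2 * t := by
  have hT : ‖T‖ ≤ t + ‖T‖ * (1 / 2) := by
    let _ := NormedSpace.restrictScalars ℝ 𝕜 E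
    refine T.opNorm_le_of_unit_norm (by positivity) fun x hx => ?_
    obtain ⟨v, hv, hxv⟩ := exists_norm_sub_le_of_isCover hN (mem_closedBall_zero_iff.2 hx.le)
    calc ‖T x‖ = ‖T v + T (x - v)‖ := by rw [← map_add, add_sub_cancel]
      _ ≤ ‖T v‖ + ‖T (x - v)‖ := norm_add_le _ _
      _ ≤ t + ‖T‖ * (1 / 2) :=
        add_le_add (h v hv) ((T.le_opNorm _).trans
          (mul_le_mul_of_nonneg_left (by simpa using hxv) (norm_nonneg T)))
  linarith

variable {ι : Type} [Fintype ι] [DecidableEq ι]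

lemma norm_le_four_mul_of_isCover {N : Set (EuclideanSpace ℂ ι)}
    (hN : IsCover (1 / 2) (closedBall 0 1) N) (ht : 0 ≤ t) {X : Matrix ι ι ℂ}
    (h : ∀ u ∈ N, ∀ v ∈ N, (star u.ofLp ⬝ᵥ X *ᵥ v.ofLp).re ≤ t) : ‖X‖ ≤ 4 * t := by
  rw [show 4 * t = 2 * (2 * t) by ring, l2_opNorm_def]
  refine opNorm_le_two_mul_of_isCover hN (by positivity) fun v hv =>
    norm_le_two_mul_of_isCover (𝕜 := ℂ) hN ht fun u hu => ?_
  rw [EuclideanSpace.inner_eq_star_dotProduct, dotProduct_comm]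
  exact h u hu v hv

open MeasureTheory in
lemma measureReal_four_mul_lt_norm_le {Ω : Type*} [MeasurableSpace Ω] {μ : Measure Ω}
    [IsFiniteMeasure μ] {X : Ω → Matrix ι ι ℂ} {p : ℝ} (ht : 0 ≤ t)
    (hX : ∀ u v : ι → ℂ, l2norm u ≤ 1 → l2norm v ≤ 1 →
      μ.real {ω | t ≤ (star u ⬝ᵥ X ω *ᵥ v).re} ≤ p) :
    μ.real {ω | 4 * t < ‖X ω‖} ≤ 625 ^ Fintype.card ι * p := by
  have hp : 0 ≤ p :=
    measureReal_nonneg.trans (hX 0 0 (l2norm_zero.trans_le zero_le_one)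
      (l2norm_zero.trans_le zero_le_one))
  obtain ⟨N, hN_ball, hN_card, hN_cover⟩ := exists_isCover_closedBall (EuclideanSpace ℂ ι)
  have hfinrank : Module.finrank ℝ (EuclideanSpace ℂ ι) = 2 * Fintype.card ι := by
    rw [finrank_real_of_complex, finrank_euclideanSpace]
  have hcard : (N ×ˢ N).card ≤ 625 ^ Fintype.card ι :=
    calc (N ×ˢ N).card = N.card ^ 2 := by rw [Finset.card_product, sq]
      _ ≤ (5 ^ (2 * Fintype.card ι)) ^ 2 := by rw [← hfinrank]; gcongr
      _ = 625 ^ Fintype.card ι := by rw [← pow_mul, mul_right_comm, pow_mul]; norm_num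
  have hunion : {ω | 4 * t < ‖X ω‖} ⊆
      ⋃ q ∈ N ×ˢ N, {ω | t ≤ (star q.1.ofLp ⬝ᵥ X ω *ᵥ q.2.ofLp).re} := by
    intro ω hω
    by_contra hnot
    simp only [Set.mem_iUnion, not_exists, Finset.mem_product, Prod.forall] at hnot
    exact hω.not_ge (norm_le_four_mul_of_isCover hN_cover ht fun u hu v hv =>
      (not_le.1 (hnot u v ⟨hu, hv⟩)).le)
  calc μ.real {ω | 4 * t < ‖X ω‖}
      ≤ ∑ q ∈ N ×ˢ N, μ.real {ω | t ≤ (star q.1.ofLp ⬝ᵥ X ω *ᵥ q.2.ofLp).re} :=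
        (measureReal_mono hunion (measure_ne_top _ _)).trans (measureReal_biUnion_finset_le _ _)
    _ ≤ (N ×ˢ N).card • p := Finset.sum_le_card_nsmul _ _ _ fun q hq =>
        hX _ _ (hN_ball _ (Finset.mem_product.1 hq).1) (hN_ball _ (Finset.mem_product.1 hq).2)
    _ ≤ 625 ^ Fintype.card ι * p := by
        rw [nsmul_eq_mul]
        exact mul_le_mul_of_nonneg_right (mod_cast hcard) hp

end Nets

/-! ### Concentration of the estimate of the Gram matrix -/

section Concentration

open MeasureTheory ProbabilityTheory

lemma hasSubgaussianMGF_mono {Ω : Type*} [MeasurableSpace Ω] {μ : Measure Ω} {X : Ω → ℝ}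
    {σ τ : NNReal} (h : HasSubgaussianMGF X σ μ) (hστ : σ ≤ τ) : HasSubgaussianMGF X τ μ :=
  ⟨h.integrable_exp_mul, fun s => (h.mgf_le s).trans (Real.exp_le_exp.2 (by gcongr))⟩

lemma measureReal_pi_le_sum_mul_sub_integral_le {ι : Type*} [Fintype ι] {Ω : ι → Type*}
    [∀ i, MeasurableSpace (Ω i)] {μ : ∀ i, Measure (Ω i)} [∀ i, IsProbabilityMeasure (μ i)]
    {X : ∀ i, Ω i → ℝ} (hX : ∀ i, AEMeasurable (X i) (μ i))
    (hX_mem : ∀ i, ∀ᵐ x ∂μ i, X i x ∈ Set.Icc (-1) 1) {w : ι → ℝ} {σ t : ℝ}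
    (hw : ∑ i, w i ^ 2 ≤ σ) (ht : 0 ≤ t) :
    (Measure.pi μ).real {ω | t ≤ ∑ i, w i * (X i (ω i) - ∫ x, X i x ∂μ i)}
      ≤ Real.exp (-t ^ 2 / (2 * σ)) := by
  lift σ to NNReal using (Finset.sum_nonneg fun i _ => sq_nonneg (w i)).trans hw
  set Y : ∀ i, Ω i → ℝ := fun i x => w i * (X i x - ∫ x, X i x ∂μ i)
  have hY : ∀ i, HasSubgaussianMGF (Y i) (‖w i‖₊ ^ 2) (μ i) := fun i => by
    have h := (hasSubgaussianMGF_of_mem_Icc (hX i) (hX_mem i)).const_mul (w i)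
    refine hasSubgaussianMGF_mono h (NNReal.coe_le_coe.1 ?_)
    norm_num
    exact (mul_one (w i ^ 2)).le
  have hY_meas : ∀ i, AEMeasurable (Y i) (μ i) := fun i => (hY i).aemeasurable
  have hY_pi : ∀ i ∈ Finset.univ,
      HasSubgaussianMGF (fun ω : ∀ i, Ω i => Y i (ω i)) (‖w i‖₊ ^ 2) (Measure.pi μ) := fun i _ => by
    have heval := measurePreserving_eval μ i
    exact HasSubgaussianMGF.of_map (X := Y i) heval.measurable.aemeasurable
      (by rw [heval.map_eq]; exact hY i)
  have hsum := HasSubgaussianMGF.sum_of_iIndepFun (iIndepFun_pi hY_meas) hY_pi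
  refine (hasSubgaussianMGF_mono hsum (τ := σ) (NNReal.coe_le_coe.1 ?_)).measure_ge_le ht
  simpa using hw

variable {n M : ℕ}

lemma gram_sysMatrix_apply (U : Fin M → Circuit (Fin n)) (a : Fin M → ℝ) (j k : Fin M) :
    ((sysMatrix U a)ᴴ * sysMatrix U a) j k
      = a j * a k * ((U j).toMatrixᴴ * (U k).toMatrix) (zeroState _) (zeroState _) := by
  simp only [Matrix.mul_apply, Finset.mul_sum, conjTranspose_apply, sysMatrix, Circuit.state,
    star_mul', RCLike.star_def, Complex.conj_ofReal]
  exact Finset.sum_congr rfl fun x _ => by ring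

lemma sum_outcomeSign {S : ℕ} (ω : Record M S) (j k : Fin M) (im : Bool) :
    ∑ r, outcomeSign (ω (j, k, im, r)) = 2 * (zeroCount ω j k im : ℝ) - S := by
  have hsign : ∀ b, outcomeSign b = 2 * (if b = false then 1 else 0) - 1 := by
    intro b
    cases b <;> norm_num [outcomeSign]
  simp_rw [hsign, Finset.sum_sub_distrib, ← Finset.mul_sum, zeroCount]
  simp

/-- The coefficient of `⟨aⱼ|aₖ⟩` in the sesquilinear form of `A† A` at `u, v`. -/
def formCoeff (a : Fin M → ℝ) (u v : Fin M → ℂ) (j k : Fin M) : ℂ :=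
  star (u j) * (a j * a k) * v k

/-- The weight with which the outcome of one run enters the real part of the sesquilinear form of
`V̂` at `u, v`; the conjugate turns the imaginary parts into the sign with which they occur. -/
def formWeight (a : Fin M → ℝ) (S : ℕ) (u v : Fin M → ℂ) (i : Fin M × Fin M × Bool × Fin S) : ℝ :=
  (S : ℝ)⁻¹ * partOf i.2.2.1 (star (formCoeff a u v i.1 i.2.1))

lemma sum_partOf_star_mul_partOf (z w : ℂ) :
    ∑ im, partOf im (star z) * partOf im w = (z * w).re := by
  simp [partOf, Complex.mul_re]
  ring

lemma re_dotProduct_VHat_sub_gram_mulVec {S : ℕ} (hS : 0 < S) (a : Fin M → ℝ)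
    (U : Fin M → Circuit (Fin n)) (ω : Record M S) (u v : Fin M → ℂ) :
    (star u ⬝ᵥ (VHat a S (zeroCount ω) - (sysMatrix U a)ᴴ * sysMatrix U a) *ᵥ v).re
      = ∑ i, formWeight a S u v i * (outcomeSign (ω i) - partOf i.2.2.1
          (((U i.1).toMatrixᴴ * (U i.2.1).toMatrix) (zeroState _) (zeroState _))) := by
  have hS' : (S : ℝ) ≠ 0 := by exact_mod_cast hS.ne'
  simp only [Fintype.sum_prod_type, dotProduct, mulVec, Finset.mul_sum, Complex.re_sum]
  refine Finset.sum_congr rfl fun j _ => Finset.sum_congr rfl fun k _ => ?_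
  rw [Matrix.sub_apply, gram_sysMatrix_apply, VHat]
  set g := ((U j).toMatrixᴴ * (U k).toMatrix) (zeroState _) (zeroState _)
  set e := vHat S (zeroCount ω) j k - g with he
  have hpart : ∀ im, partOf im e = 2 * (zeroCount ω j k im : ℝ) / S - 1 - partOf im g := by
    have hcast : vHat S (zeroCount ω) j k
        = ((2 * (zeroCount ω j k false : ℝ) / S - 1 : ℝ) : ℂ)
          + ((2 * (zeroCount ω j k true : ℝ) / S - 1 : ℝ) : ℂ) * Complex.I := by
      push_cast [vHat]
      rfl
    intro im
    rw [he, hcast]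
    cases im <;> simp only [partOf] <;> simp
  calc (star u j * ((a j * a k * vHat S (zeroCount ω) j k - a j * a k * g) * v k)).re
      = (formCoeff a u v j k * e).re := by
        rw [formCoeff, he, Pi.star_apply]
        ring_nf
    _ = ∑ im, partOf im (star (formCoeff a u v j k)) * partOf im e :=
        (sum_partOf_star_mul_partOf _ _).symm
    _ = _ := Finset.sum_congr rfl fun im _ => by
        simp only [formWeight]
        rw [← Finset.mul_sum, Finset.sum_sub_distrib, sum_outcomeSign, hpart]
        simp only [Finset.sum_const, Finset.card_univ, Fintype.card_fin, nsmul_eq_mul]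
        field_simp

lemma conjTranspose_toMatrix_mul_mem_unitaryGroup {Q : Type} [Fintype Q] [DecidableEq Q]
    (U V : Circuit Q) : U.toMatrixᴴ * V.toMatrix ∈ unitaryGroup (Q → Bool) ℂ :=
  mul_mem (Unitary.star_mem U.toMatrix_mem_unitaryGroup) V.toMatrix_mem_unitaryGroup

lemma sq_le_gammaTwo (a : Fin M → ℝ) (j : Fin M) : a j ^ 2 ≤ gammaTwo a :=
  le_ciSup (f := fun j => a j ^ 2) (Set.finite_range _).bddAbove j

lemma sum_norm_formCoeff_sq_le (a : Fin M → ℝ) (u v : Fin M → ℂ) :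
    ∑ j, ∑ k, ‖formCoeff a u v j k‖ ^ 2 ≤ gammaTwo a ^ 2 * (l2norm u ^ 2 * l2norm v ^ 2) := by
  rw [l2norm_sq, l2norm_sq, Finset.sum_mul_sum, Finset.mul_sum]
  simp only [Finset.mul_sum]
  refine Finset.sum_le_sum fun j _ => Finset.sum_le_sum fun k _ => ?_
  calc ‖formCoeff a u v j k‖ ^ 2 = a j ^ 2 * a k ^ 2 * (‖u j‖ ^ 2 * ‖v k‖ ^ 2) := by
        simp only [formCoeff, norm_mul, norm_star, Complex.norm_real, Real.norm_eq_abs, mul_pow,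
          sq_abs]
        ring
    _ ≤ gammaTwo a ^ 2 * (‖u j‖ ^ 2 * ‖v k‖ ^ 2) := by
        rw [sq (gammaTwo a)]
        gcongr
        · exact (sq_nonneg (a j)).trans (sq_le_gammaTwo a j)
        · exact sq_le_gammaTwo a j
        · exact sq_le_gammaTwo a k

lemma sum_formWeight_sq_le {S : ℕ} (hS : 0 < S) (a : Fin M → ℝ) {u v : Fin M → ℂ}
    (hu : l2norm u ≤ 1) (hv : l2norm v ≤ 1) :
    ∑ i, formWeight a S u v i ^ 2 ≤ gammaTwo a ^ 2 / S := by
  have hS' : (S : ℝ) ≠ 0 := by exact_mod_cast hS.ne'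
  have hsum : ∑ i, formWeight a S u v i ^ 2 = (∑ j, ∑ k, ‖formCoeff a u v j k‖ ^ 2) / S := by
    simp only [Fintype.sum_prod_type, formWeight, Finset.sum_div, Finset.sum_const,
      Finset.card_univ, Fintype.card_fin, nsmul_eq_mul]
    refine Finset.sum_congr rfl fun j _ => Finset.sum_congr rfl fun k _ => ?_
    rw [Complex.sq_norm, Complex.normSq_apply]
    simp only [Fintype.sum_bool, partOf]
    simp
    field_simp
    ring
  rw [hsum]
  gcongr
  calc ∑ j, ∑ k, ‖formCoeff a u v j k‖ ^ 2
      ≤ gammaTwo a ^ 2 * (l2norm u ^ 2 * l2norm v ^ 2) := sum_norm_formCoeff_sq_le a u v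
    _ ≤ gammaTwo a ^ 2 * 1 := by
        gcongr
        exact mul_le_one₀ (pow_le_one₀ (l2norm_nonneg u) hu) (by positivity)
          (pow_le_one₀ (l2norm_nonneg v) hv)
    _ = gammaTwo a ^ 2 := mul_one _

section Tests

variable {U : Fin M → Circuit (Fin n)} {test : Fin M → Fin M → Bool → Circuit (Option (Fin n))}
  (htest : ∀ j k im, IsHadamardTest (test j k im) im ((U j).toMatrixᴴ * (U k).toMatrix)) (S : ℕ)

include htest

lemma isProbabilityMeasure_outcomeLaw (j k : Fin M) (im : Bool) :
    IsProbabilityMeasure ((test j k im).outcomeLaw none) :=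
  (htest j k im).isProbabilityMeasure (conjTranspose_toMatrix_mul_mem_unitaryGroup _ _)

lemma isProbabilityMeasure_recordLaw : IsProbabilityMeasure (recordLaw test S) := by
  have := isProbabilityMeasure_outcomeLaw htest
  unfold recordLaw
  infer_instance

variable {S}

lemma measureReal_recordLaw_le_re_le (hS : 0 < S) (a : Fin M → ℝ) {t : ℝ} (ht : 0 ≤ t)
    {u v : Fin M → ℂ} (hu : l2norm u ≤ 1) (hv : l2norm v ≤ 1) :
    (recordLaw test S).real {ω | t ≤ (star u ⬝ᵥ
        (VHat a S (zeroCount ω) - (sysMatrix U a)ᴴ * sysMatrix U a) *ᵥ v).re}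
      ≤ Real.exp (-t ^ 2 / (2 * (gammaTwo a ^ 2 / S))) := by
  have := isProbabilityMeasure_outcomeLaw htest
  have hmean : ∀ i : Fin M × Fin M × Bool × Fin S,
      ∫ b, outcomeSign b ∂(test i.1 i.2.1 i.2.2.1).outcomeLaw none
        = partOf i.2.2.1 (((U i.1).toMatrixᴴ * (U i.2.1).toMatrix) (zeroState _) (zeroState _)) :=
    fun i => (htest _ _ _).integral_outcomeSign (conjTranspose_toMatrix_mul_mem_unitaryGroup _ _)
  simp only [re_dotProduct_VHat_sub_gram_mulVec hS, ← hmean]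
  refine measureReal_pi_le_sum_mul_sub_integral_le
    (fun i => (measurable_of_finite outcomeSign).aemeasurable) (fun i => .of_forall fun b => ?_)
    (sum_formWeight_sq_le hS a hu hv) ht
  cases b <;> simp [outcomeSign]

lemma one_sub_le_measureReal_norm_VHat_sub_le (hS : 0 < S) (a : Fin M → ℝ) {t : ℝ} (ht : 0 ≤ t) :
    1 - 625 ^ M * Real.exp (-t ^ 2 / (2 * (gammaTwo a ^ 2 / S))) ≤
      (recordLaw test S).real
        {ω | ‖VHat a S (zeroCount ω) - (sysMatrix U a)ᴴ * sysMatrix U a‖ ≤ 4 * t} := by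
  have := isProbabilityMeasure_recordLaw htest S
  have hbad := measureReal_four_mul_lt_norm_le (μ := recordLaw test S) ht fun u v =>
    measureReal_recordLaw_le_re_le htest hS a ht
  rw [Fintype.card_fin] at hbad
  have hcompl := probReal_compl_eq_one_sub (μ := recordLaw test S) (Set.toFinite
    {ω | 4 * t < ‖VHat a S (zeroCount ω) - (sysMatrix U a)ᴴ * sysMatrix U a‖}).measurableSet
  simp only [Set.compl_ofPred, not_lt] at hcompl
  linarith

end Tests

end Concentration

/-! ### Straight-line programs -/

section StraightLine

variable {I : Type}

open Classical in
/-- Overwriting a register, with the classical decision of equality of registers that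
`Instr.exec` uses. -/
def write {R : Type} (mem : R → ℂ) (d : R) (v : ℂ) : R → ℂ := Function.update mem d v

lemma write_of_ne {R : Type} {r d : R} (h : r ≠ d) (mem : R → ℂ) (v : ℂ) :
    write mem d v r = mem r := by
  classical exact Function.update_of_ne h _ _

lemma write_self {R : Type} (mem : R → ℂ) (d : R) (v : ℂ) : write mem d v d = v := by
  classical exact Function.update_self _ _ _

/-- The memory after `code` has been run on the input `x`, with the registers `ℕ` as workspace. -/
def run (code : List (Instr (I ⊕ ℕ))) (x : I → ℂ) : I ⊕ ℕ → ℂ :=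
  code.foldl Instr.exec (Sum.elim x fun _ => 0)

/-- After `code` has been run, the value of the function `f` of the inputs is held by an input
register or by a workspace register with index below the length of `code`; the bound keeps the
register with index `code.length` free for the next instruction. -/
def Computes (code : List (Instr (I ⊕ ℕ))) (f : (I → ℂ) → ℂ) : Prop :=
  ∃ r : I ⊕ ℕ, (∀ w, r = Sum.inr w → w < code.length) ∧ ∀ x, run code x r = f x

/-- Whenever the functions in `S` have been computed, `m` further instructions suffice for those
in `T`. The code is allowed to have computed more than `S`, so that derivations compose. -/
def Derives (S T : Set ((I → ℂ) → ℂ)) (m : ℕ) : Prop :=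
  ∀ code, (∀ f ∈ S, Computes code f) → ∃ code' : List (Instr (I ⊕ ℕ)), code'.length ≤ m ∧
    (∀ f, Computes code f → Computes (code ++ code') f) ∧ ∀ f ∈ T, Computes (code ++ code') f

variable {S S' T T' : Set ((I → ℂ) → ℂ)} {f g : (I → ℂ) → ℂ} {m m' : ℕ}

lemma run_append_singleton (code : List (Instr (I ⊕ ℕ))) (ins : Instr (I ⊕ ℕ)) (x : I → ℂ) :
    run (code ++ [ins]) x = ins.exec (run code x) := by
  rw [run, List.foldl_append, List.foldl_cons, List.foldl_nil, run]

lemma Derives.mono (h : Derives S T m) (hS : S ⊆ S') (hT : T' ⊆ T) (hm : m ≤ m') :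
    Derives S' T' m' := fun code hcode => by
  obtain ⟨code', hlen, hkeep, hnew⟩ := h code fun f hf => hcode f (hS hf)
  exact ⟨code', hlen.trans hm, hkeep, fun f hf => hnew f (hT hf)⟩

lemma Derives.of_subset (h : T ⊆ S) : Derives S T 0 := fun code hcode =>
  ⟨[], le_rfl, by simp, fun f hf => by simpa using hcode f (h hf)⟩

lemma Derives.of_mem (h : f ∈ S) : Derives S {f} 0 :=
  .of_subset (Set.singleton_subset_iff.2 h)

lemma Derives.trans (h : Derives S T m) (h' : Derives (S ∪ T) T' m') :
    Derives S (T ∪ T') (m + m') := fun code hcode => by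
  obtain ⟨code₁, hlen₁, hkeep₁, hnew₁⟩ := h code hcode
  obtain ⟨code₂, hlen₂, hkeep₂, hnew₂⟩ := h' (code ++ code₁) fun f hf =>
    hf.elim (fun hf => hkeep₁ f (hcode f hf)) (hnew₁ f)
  refine ⟨code₁ ++ code₂, by rw [List.length_append]; omega, ?_, ?_⟩ <;>
    rw [← List.append_assoc]
  · exact fun f hf => hkeep₂ f (hkeep₁ f hf)
  · exact fun f hf => hf.elim (fun hf => hkeep₂ f (hnew₁ f hf)) (hnew₂ f)

lemma Derives.union (h : Derives S T m) (h' : Derives S T' m') : Derives S (T ∪ T') (m + m') :=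
  h.trans (h'.mono Set.subset_union_left subset_rfl le_rfl)

lemma Derives.image {ι : Type} (s : Finset ι) {F : ι → (I → ℂ) → ℂ}
    (h : ∀ i ∈ s, Derives S {F i} m) : Derives S (F '' s) (s.card * m) := by
  classical
  induction s using Finset.induction_on with
  | empty => simpa using Derives.of_subset (Set.empty_subset S)
  | insert i s hi ih =>
    have hcons := (h i (by simp)).union (ih fun j hj => h j (by simp [hj]))
    rw [Finset.card_insert_of_notMem hi, Finset.coe_insert, Set.image_insert_eq]
    exact hcons.mono subset_rfl subset_rfl (by ring_nf; rfl)

lemma Derives.range {ι : Type} [Fintype ι] {F : ι → (I → ℂ) → ℂ}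
    (h : ∀ i, Derives S {F i} m) : Derives S (Set.range F) (Fintype.card ι * m) := by
  simpa using Derives.image Finset.univ fun i _ => h i

lemma Derives.iUnion_range_of_forall_lt {ι : Type} {N : ℕ} {F : Fin N → ι → (I → ℂ) → ℂ}
    (h : ∀ i S', S ⊆ S' → (∀ l < i, Set.range (F l) ⊆ S') → Derives S' (Set.range (F i)) m) :
    Derives S (⋃ i, Set.range (F i)) (N * m) := by
  induction N with
  | zero => simpa using Derives.of_subset (Set.empty_subset S)
  | succ N ih =>
    have hinit := ih (F := fun i => F i.castSucc) fun i S' hS hF =>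
      h i.castSucc S' hS fun l hl => by
        obtain ⟨l, rfl⟩ := Fin.exists_castSucc_eq.2 (hl.trans (Fin.castSucc_lt_last i)).ne
        exact hF l hl
    have hlast := h (Fin.last N) (S ∪ ⋃ i : Fin N, Set.range (F i.castSucc))
      Set.subset_union_left fun l hl => by
        obtain ⟨l, rfl⟩ := Fin.exists_castSucc_eq.2 hl.ne
        exact (Set.subset_iUnion (fun i : Fin N => Set.range (F i.castSucc)) l).trans
          Set.subset_union_right
    refine (hinit.trans hlast).mono subset_rfl (Set.iUnion_subset fun i => ?_) (by ring_nf; rfl)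
    induction i using Fin.lastCases with
    | last => exact Set.subset_union_right
    | cast i =>
      exact (Set.subset_iUnion (fun i : Fin N => Set.range (F i.castSucc)) i).trans
        Set.subset_union_left

lemma derives_of_exec_eq_write
    (h : ∀ code : List (Instr (I ⊕ ℕ)), (∀ f ∈ S, Computes code f) → ∃ ins : Instr (I ⊕ ℕ),
      ∀ x, ins.exec (run code x) = write (run code x) (Sum.inr code.length) (g x)) :
    Derives S {g} 1 := by
  intro code hcode
  obtain ⟨ins, hins⟩ := h code hcode
  refine ⟨[ins], le_rfl, ?_, ?_⟩
  · rintro f ⟨r, hr, hrun⟩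
    refine ⟨r, fun w hw => (hr w hw).trans (by simp), fun x => ?_⟩
    have hne : r ≠ Sum.inr code.length := fun h => (hr _ h).false
    rw [run_append_singleton, hins, write_of_ne hne, hrun]
  · rintro _ rfl
    refine ⟨Sum.inr code.length, fun w hw => ?_, fun x => ?_⟩
    · simp [← Sum.inr_injective hw]
    · rw [run_append_singleton, hins, write_self]

lemma derives_one : Derives S {fun _ => 1} 1 :=
  derives_of_exec_eq_write fun code _ => ⟨.one (Sum.inr code.length), fun _ => rfl⟩

lemma derives_I : Derives S {fun _ => Complex.I} 1 :=
  derives_of_exec_eq_write fun code _ => ⟨.imag (Sum.inr code.length), fun _ => rfl⟩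

lemma Derives.star (h : Derives S {f} m) : Derives S {fun x => star (f x)} (m + 1) := by
  refine (h.trans (derives_of_exec_eq_write fun code hcode => ?_)).mono subset_rfl
    Set.subset_union_right le_rfl
  obtain ⟨r, -, hr⟩ := hcode f (by simp)
  exact ⟨.conj (Sum.inr code.length) r, fun x => by rw [← hr x]; rfl⟩

lemma Derives.binary {mk : (I ⊕ ℕ) → (I ⊕ ℕ) → (I ⊕ ℕ) → Instr (I ⊕ ℕ)} {op : ℂ → ℂ → ℂ}
    (hmk : ∀ mem d p q, (mk d p q).exec mem = write mem d (op (mem p) (mem q)))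
    (h : Derives S {f} m) (h' : Derives S {g} m') :
    Derives S {fun x => op (f x) (g x)} (m + m' + 1) := by
  refine ((h.union h').trans (derives_of_exec_eq_write fun code hcode => ?_)).mono subset_rfl
    Set.subset_union_right le_rfl
  obtain ⟨p, -, hp⟩ := hcode f (by simp)
  obtain ⟨q, -, hq⟩ := hcode g (by simp)
  exact ⟨mk (Sum.inr code.length) p q, fun x => by rw [hmk, hp, hq]⟩

lemma Derives.add (h : Derives S {f} m) (h' : Derives S {g} m') :
    Derives S {fun x => f x + g x} (m + m' + 1) :=
  h.binary (mk := .add) (fun _ _ _ _ => rfl) h'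

lemma Derives.sub (h : Derives S {f} m) (h' : Derives S {g} m') :
    Derives S {fun x => f x - g x} (m + m' + 1) :=
  h.binary (mk := .sub) (fun _ _ _ _ => rfl) h'

lemma Derives.mul (h : Derives S {f} m) (h' : Derives S {g} m') :
    Derives S {fun x => f x * g x} (m + m' + 1) :=
  h.binary (mk := .mul) (fun _ _ _ _ => rfl) h'

lemma Derives.div (h : Derives S {f} m) (h' : Derives S {g} m') :
    Derives S {fun x => f x / g x} (m + m' + 1) :=
  h.binary (mk := .div) (fun _ _ _ _ => rfl) h'

lemma Derives.of_eq (h : Derives S {f} m) (hfg : ∀ x, f x = g x) (hm : m ≤ m') :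
    Derives S {g} m' := by
  obtain rfl : f = g := funext hfg
  exact h.mono subset_rfl subset_rfl hm

lemma derives_zero : Derives S {fun _ => 0} 3 :=
  (derives_one.sub derives_one).of_eq (fun _ => sub_self 1) le_rfl

lemma Derives.sum {ι : Type} (s : Finset ι) {F : ι → (I → ℂ) → ℂ}
    (h : ∀ i ∈ s, Derives S {F i} m) :
    Derives S {fun x => ∑ i ∈ s, F i x} (s.card * (m + 1) + 3) := by
  classical
  induction s using Finset.induction_on with
  | empty => simpa using derives_zero
  | insert i s hi ih =>
    have hcons := (h i (by simp)).add (ih fun j hj => h j (by simp [hj]))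
    rw [Finset.card_insert_of_notMem hi]
    exact hcons.of_eq (fun x => by rw [Finset.sum_insert hi]) (by ring_nf; rfl)

lemma Derives.exists_program {O : Type} {F : O → (I → ℂ) → ℂ}
    (h : Derives (Set.range fun (i : I) (x : I → ℂ) => x i) (Set.range F) m) :
    ∃ P : Program I O, P.steps ≤ m ∧ ∀ x o, P.eval x o = F o x := by
  obtain ⟨code, hlen, -, hcode⟩ := h [] <| by
    rintro _ ⟨i, rfl⟩
    exact ⟨Sum.inl i, by simp, fun x => rfl⟩
  choose r _ hr using fun o => hcode (F o) ⟨o, rfl⟩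
  exact ⟨⟨ℕ, code, r⟩, hlen, fun x o => hr o x⟩

end StraightLine

/-! ### Solving a linear system by orthogonalization of its rows -/

section Solver

variable {M : ℕ} (Q : Matrix (Fin M) (Fin M) ℂ)

/-- The conjugate of a row, so that equation `i` of `Q x = b` reads `⟪rowVec Q i, x⟫ = b i`. -/
def rowVec (i : Fin M) : EuclideanSpace ℂ (Fin M) :=
  WithLp.toLp 2 fun j => star (Q i j)

/-- The Gram–Schmidt orthogonalization of the conjugated rows. -/
def orthoRow (i : Fin M) : EuclideanSpace ℂ (Fin M) :=
  InnerProductSpace.gramSchmidt ℂ (rowVec Q) i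

/-- The squared norm of an orthogonalized row, in the arithmetic form in which it is computed. -/
def rowNormSq (i : Fin M) : ℂ :=
  ∑ j, star (orthoRow Q i j) * orthoRow Q i j

/-- The coefficient of the projection of row `i` onto the orthogonalized row `l`. -/
def rowCoeff (l i : Fin M) : ℂ :=
  (∑ j, star (orthoRow Q l j) * star (Q i j)) / rowNormSq Q l

lemma inner_eq_sum {ι : Type*} [Fintype ι] (u v : EuclideanSpace ℂ ι) :
    inner ℂ u v = ∑ j, star (u j) * v j := by
  simp only [PiLp.inner_apply, RCLike.inner_apply, RCLike.star_def, mul_comm]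

lemma rowNormSq_eq_inner (i : Fin M) :
    rowNormSq Q i = inner ℂ (orthoRow Q i) (orthoRow Q i) :=
  (inner_eq_sum _ _).symm

lemma rowVec_eq_orthoRow_add_sum (i : Fin M) :
    rowVec Q i = orthoRow Q i + ∑ l ∈ Finset.Iio i, rowCoeff Q l i • orthoRow Q l := by
  have hcoeff : ∀ l, rowCoeff Q l i
      = inner ℂ (orthoRow Q l) (rowVec Q i) / (‖orthoRow Q l‖ : ℂ) ^ 2 := fun l => by
    rw [rowCoeff, rowNormSq_eq_inner, inner_self_eq_norm_sq_to_K, inner_eq_sum]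
    rfl
  simp only [hcoeff]
  exact InnerProductSpace.gramSchmidt_def'' ℂ (rowVec Q) i

lemma orthoRow_apply (i j : Fin M) :
    orthoRow Q i j = star (Q i j) - ∑ l ∈ Finset.Iio i, rowCoeff Q l i * orthoRow Q l j := by
  have h := congrArg (fun v : EuclideanSpace ℂ (Fin M) => v j) (rowVec_eq_orthoRow_add_sum Q i)
  simp only [PiLp.add_apply, WithLp.ofLp_sum, Finset.sum_apply, PiLp.smul_apply, smul_eq_mul] at h
  exact eq_sub_of_add_eq h.symm

lemma inner_rowVec (i : Fin M) (v : EuclideanSpace ℂ (Fin M)) :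
    inner ℂ (rowVec Q i) v = (Q *ᵥ v.ofLp) i := by
  simp only [inner_eq_sum, mulVec, dotProduct, rowVec, star_star]

lemma inner_rowVec_orthoRow_of_lt {i k : Fin M} (h : i < k) :
    inner ℂ (rowVec Q i) (orthoRow Q k) = 0 := by
  rw [inner_eq_zero_symm]
  exact InnerProductSpace.gramSchmidt_inv_triangular ℂ (rowVec Q) h

lemma inner_rowVec_orthoRow_self (i : Fin M) :
    inner ℂ (rowVec Q i) (orthoRow Q i) = rowNormSq Q i := by
  rw [rowVec_eq_orthoRow_add_sum, inner_add_left, sum_inner, rowNormSq_eq_inner,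
    Finset.sum_eq_zero, add_zero]
  intro l hl
  rw [inner_smul_left, orthoRow, orthoRow, InnerProductSpace.gramSchmidt_orthogonal ℂ (rowVec Q)
    (Finset.mem_Iio.1 hl).ne, mul_zero]

/-- The coefficient of the orthogonalized row `k` in the correction that makes the approximate
solution `v` satisfy equation `k`. -/
def stepCoeff (b v : Fin M → ℂ) (k : Fin M) : ℂ :=
  (b k - ∑ j, Q k j * v j) / rowNormSq Q k

/-- The solution of the first `k` equations of the system `Q x = b`. A correction along the
orthogonalized row `k` does not disturb the equations before `k`. -/
def partialSol (b : Fin M → ℂ) : ℕ → Fin M → ℂ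
  | 0 => 0
  | k + 1 => if h : k < M then
      partialSol b k + stepCoeff Q b (partialSol b k) ⟨k, h⟩ • (orthoRow Q ⟨k, h⟩).ofLp
    else partialSol b k

variable {Q}

lemma linearIndependent_rowVec (hQ : IsUnit Q.det) : LinearIndependent ℂ (rowVec Q) := by
  have hrows : LinearIndependent ℂ (Qᴴᵀ).row := by
    rw [linearIndependent_rows_iff_isUnit, isUnit_iff_isUnit_det, det_transpose,
      det_conjTranspose]
    exact hQ.star
  exact hrows.map' (WithLp.linearEquiv 2 ℂ (Fin M → ℂ)).symm.toLinearMap (LinearEquiv.ker _)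

lemma rowNormSq_ne_zero (hQ : IsUnit Q.det) (i : Fin M) : rowNormSq Q i ≠ 0 := by
  rw [rowNormSq_eq_inner, inner_self_ne_zero]
  exact InnerProductSpace.gramSchmidt_ne_zero i (linearIndependent_rowVec hQ)

lemma mulVec_partialSol_apply (hQ : IsUnit Q.det) (b : Fin M → ℂ) {k : ℕ} {i : Fin M}
    (hi : (i : ℕ) < k) : (Q *ᵥ partialSol Q b k) i = b i := by
  induction k with
  | zero => omega
  | succ k ih =>
    rw [partialSol]
    split_ifs with hk
    · rw [mulVec_add, mulVec_smul, Pi.add_apply, Pi.smul_apply, ← inner_rowVec Q i (orthoRow Q _)]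
      obtain hlt | rfl := Nat.lt_succ_iff_lt_or_eq.1 hi
      · rw [inner_rowVec_orthoRow_of_lt Q (show i < ⟨k, hk⟩ from hlt), ih hlt, smul_zero, add_zero]
      · rw [inner_rowVec_orthoRow_self, stepCoeff, smul_eq_mul,
          div_mul_cancel₀ _ (rowNormSq_ne_zero hQ i), mulVec, dotProduct, add_sub_cancel]
    · exact ih (by omega)

lemma partialSol_eq_inv_mulVec (hQ : IsUnit Q.det) (b : Fin M → ℂ) :
    partialSol Q b M = Q⁻¹ *ᵥ b := by
  have hsolves : Q *ᵥ partialSol Q b M = b := funext fun i => mulVec_partialSol_apply hQ b i.2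
  rw [← hsolves, mulVec_mulVec, nonsing_inv_mul _ hQ, one_mulVec, hsolves]

end Solver

section SolverProgram

variable {M : ℕ} {I : Type} {S : Set ((I → ℂ) → ℂ)} {Q : (I → ℂ) → Matrix (Fin M) (Fin M) ℂ}
  {b : (I → ℂ) → Fin M → ℂ}

lemma derives_sum_mul {f g : Fin M → (I → ℂ) → ℂ} (hf : ∀ j, f j ∈ S) (hg : ∀ j, g j ∈ S) :
    Derives S {fun x => ∑ j, f j x * g j x} (2 * M + 3) :=
  (Derives.sum Finset.univ fun j _ => (Derives.of_mem (hf j)).mul (.of_mem (hg j))).of_eq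
    (fun _ => rfl) (by rw [Finset.card_univ, Fintype.card_fin]; omega)

lemma derives_rowNormSq {l : Fin M} (ho : ∀ j, (fun x => orthoRow (Q x) l j) ∈ S) :
    Derives S {fun x => rowNormSq (Q x) l} (3 * M + 3) :=
  (Derives.sum Finset.univ fun j _ =>
    (Derives.of_mem (ho j)).star.mul (.of_mem (ho j))).of_eq (fun _ => rfl)
      (by rw [Finset.card_univ, Fintype.card_fin]; omega)

lemma derives_rowCoeff {l i : Fin M} (ho : ∀ j, (fun x => orthoRow (Q x) l j) ∈ S)
    (hQ : ∀ j, (fun x => Q x i j) ∈ S) :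
    Derives S {fun x => rowCoeff (Q x) l i} (7 * M + 7) := by
  have hnum : Derives S {fun x => ∑ j, star (orthoRow (Q x) l j) * star (Q x i j)} (4 * M + 3) :=
    (Derives.sum Finset.univ fun j _ =>
      (Derives.of_mem (ho j)).star.mul (Derives.of_mem (hQ j)).star).of_eq (fun _ => rfl)
        (by rw [Finset.card_univ, Fintype.card_fin]; omega)
  exact (hnum.div (derives_rowNormSq ho)).of_eq (fun _ => rfl) (by omega)

lemma derives_orthoRow_of_forall_lt {i : Fin M}
    (ho : ∀ l < i, ∀ j, (fun x => orthoRow (Q x) l j) ∈ S) (hQ : ∀ j, (fun x => Q x i j) ∈ S) :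
    Derives S (Set.range fun j x => orthoRow (Q x) i j) (21 * M ^ 2) := by
  have hcard : (Finset.Iio i).card ≤ M := (Finset.card_le_univ _).trans (Fintype.card_fin M).le
  have hM : M ≤ M ^ 2 := Nat.le_self_pow two_ne_zero M
  have hcoeff := Derives.image (S := S) (F := fun l x => rowCoeff (Q x) l i) (Finset.Iio i)
    fun l hl => derives_rowCoeff (ho l (Finset.mem_Iio.1 hl)) hQ
  refine (hcoeff.trans (Derives.range (m := 2 * M + 5) fun j => ?_)).mono subset_rfl
    Set.subset_union_right ?_
  · refine ((Derives.of_mem (Or.inl (hQ j))).star.sub (Derives.sum (Finset.Iio i)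
      (F := fun l x => rowCoeff (Q x) l i * orthoRow (Q x) l j) fun l hl =>
        (Derives.of_mem (Or.inr ⟨l, hl, rfl⟩)).mul
          (.of_mem (Or.inl (ho l (Finset.mem_Iio.1 hl) j))))).of_eq
      (fun x => (orthoRow_apply (Q x) i j).symm) (by omega)
  · rw [Fintype.card_fin]
    have := Nat.mul_le_mul_right (7 * M + 7) hcard
    nlinarith

lemma derives_orthoRow (hQ : ∀ i j, (fun x => Q x i j) ∈ S) :
    Derives S (⋃ i, Set.range fun j x => orthoRow (Q x) i j) (M * (21 * M ^ 2)) :=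
  Derives.iUnion_range_of_forall_lt fun i _ hS ho => derives_orthoRow_of_forall_lt
    (fun l hl j => ho l hl ⟨j, rfl⟩) fun j => hS (hQ i j)

lemma derives_partialSol_succ {i : Fin M} (hp : ∀ j, (fun x => partialSol (Q x) (b x) i j) ∈ S)
    (ho : ∀ j, (fun x => orthoRow (Q x) i j) ∈ S) (hQ : ∀ j, (fun x => Q x i j) ∈ S)
    (hb : (fun x => b x i) ∈ S) :
    Derives S (Set.range fun j x => partialSol (Q x) (b x) (i + 1) j) (7 * M + 8) := by
  have hcoeff : Derives S {fun x => stepCoeff (Q x) (b x) (partialSol (Q x) (b x) i) i}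
      (5 * M + 8) :=
    (((Derives.of_mem hb).sub (derives_sum_mul hQ hp)).div (derives_rowNormSq ho)).of_eq
      (fun _ => rfl) (by omega)
  refine (hcoeff.trans (Derives.range (m := 2) fun j => ?_)).mono subset_rfl
    Set.subset_union_right (by rw [Fintype.card_fin]; omega)
  refine ((Derives.of_mem (Or.inl (hp j))).add ((Derives.of_mem (Or.inr rfl)).mul
    (.of_mem (Or.inl (ho j))))).of_eq (fun x => ?_) le_rfl
  rw [partialSol, dif_pos i.2]
  rfl

lemma derives_partialSol (hQ : ∀ i j, (fun x => Q x i j) ∈ S) (hb : ∀ i, (fun x => b x i) ∈ S)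
    (ho : ∀ i j, (fun x => orthoRow (Q x) i j) ∈ S) :
    Derives S (Set.range fun j x => partialSol (Q x) (b x) M j) (M * (10 * M + 8)) := by
  have hsucc := Derives.iUnion_range_of_forall_lt (S := S) (m := 10 * M + 8)
    (F := fun (i : Fin M) j x => partialSol (Q x) (b x) (i + 1) j) fun i S' hS hp => by
      have hprev : Derives S' (Set.range fun j x => partialSol (Q x) (b x) i j) (M * 3) := by
        refine (Derives.range (m := 3) fun j => ?_).mono subset_rfl subset_rfl
          (by rw [Fintype.card_fin])
        rcases hi : (i : ℕ) with _ | l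
        · exact derives_zero.of_eq (fun _ => rfl) le_rfl
        · have hli : (⟨l, by omega⟩ : Fin M) < i := Fin.lt_def.2 (show l < (i : ℕ) by omega)
          exact (Derives.of_mem (hp _ hli ⟨j, rfl⟩)).mono subset_rfl subset_rfl (by omega)
      exact (hprev.trans (derives_partialSol_succ (fun j => Or.inr ⟨j, rfl⟩)
        (fun j => Or.inl (hS (ho i j))) (fun j => Or.inl (hS (hQ i j)))
          (Or.inl (hS (hb i))))).mono subset_rfl Set.subset_union_right (by omega)
  refine hsucc.mono subset_rfl ?_ le_rfl
  rintro _ ⟨j, rfl⟩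
  have hM : M - 1 < M := by have := j.2; omega
  refine Set.mem_iUnion.2 ⟨⟨M - 1, hM⟩, j, ?_⟩
  rw [Fin.val_mk, Nat.sub_add_cancel (by omega)]

lemma derives_solution (hQ : ∀ i j, (fun x => Q x i j) ∈ S) (hb : ∀ i, (fun x => b x i) ∈ S) :
    Derives S (Set.range fun j x => partialSol (Q x) (b x) M j) (39 * M ^ 3) := by
  refine ((derives_orthoRow hQ).trans (derives_partialSol (fun i j => Or.inl (hQ i j))
    (fun i => Or.inl (hb i)) fun i j => Or.inr (Set.mem_iUnion.2 ⟨i, j, rfl⟩))).mono subset_rfl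
      Set.subset_union_right ?_
  have h₁ : M ≤ M ^ 3 := Nat.le_self_pow three_ne_zero M
  have h₂ : M * M ≤ M ^ 3 := by nlinarith [Nat.le_self_pow two_ne_zero M]
  nlinarith

end SolverProgram

/-! ### The classical part of the algorithm -/

section ClassicalPart

variable {M : ℕ}

/-- The estimate `VHat` as a function of the inputs of the classical part. -/
def gramOfInput (x : PostInput M → ℂ) : Matrix (Fin M) (Fin M) ℂ := fun j k =>
  x (.norm j) * x (.norm k) * ((2 * x (.count j k false) / x .shots - 1)
    + (2 * x (.count j k true) / x .shots - 1) * Complex.I)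

/-- The matrix `QHat` of the shifted system as a function of the inputs of the classical part. -/
def shiftedOfInput (x : PostInput M → ℂ) : Matrix (Fin M) (Fin M) ℂ :=
  gramOfInput x ^ 2 + x .shift • 1

/-- The right-hand side of the shifted system as a function of the inputs of the classical part. -/
def rhsOfInput (x : PostInput M → ℂ) : Fin M → ℂ := gramOfInput x *ᵥ fun j => x (.rhs j)

/-- The output required of the classical part as a function of its inputs. -/
def coefficientOfInput (j : Fin M) (x : PostInput M → ℂ) : ℂ :=
  partialSol (shiftedOfInput x) (rhsOfInput x) M j * x (.norm j)

lemma coefficientOfInput_postInput {a : Fin M → ℝ} {lam : ℝ} {S : ℕ}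
    {z : Fin M → Fin M → Bool → ℕ} (hQ : IsUnit (QHat a lam S z).det) (c : Fin M → ℂ)
    (j : Fin M) :
    coefficientOfInput j (postInput a c lam S z) = alphaHat a c lam S z j * (a j : ℂ) :=
  congrArg (fun v : Fin M → ℂ => v j * (a j : ℂ)) (partialSol_eq_inv_mulVec hQ _)

variable {S : Set ((PostInput M → ℂ) → ℂ)}

lemma derives_gramOfInput (hS : ∀ i, (fun x => x i) ∈ S) :
    Derives S (Set.range fun (p : Fin M × Fin M) x => gramOfInput x p.1 p.2) (19 * M ^ 2) := by
  refine (Derives.range (m := 19) fun p => ?_).mono subset_rfl subset_rfl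
    (by rw [Fintype.card_prod, Fintype.card_fin]; nlinarith)
  have hinput : ∀ i, Derives S {fun x => x i} 0 := fun i => .of_mem (hS i)
  have hpart : ∀ im, Derives S {fun x => 2 * x (.count p.1 p.2 im) / x .shots - 1} 7 := fun im =>
    ((((derives_one.add derives_one).mul (hinput (.count p.1 p.2 im))).div
      (hinput .shots)).sub derives_one).of_eq (fun x => by norm_num) le_rfl
  exact ((hinput (.norm p.1)).mul (hinput (.norm p.2))).mul
    ((hpart false).add ((hpart true).mul derives_I))

lemma derives_shiftedOfInput (hS : ∀ i, (fun x => x i) ∈ S)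
    (hgram : ∀ j k, (fun x => gramOfInput x j k) ∈ S) :
    Derives S (Set.range fun (p : Fin M × Fin M) x => shiftedOfInput x p.1 p.2)
      ((2 * M + 7) * M ^ 2) := by
  refine (Derives.range (m := 2 * M + 7) fun p => ?_).mono subset_rfl subset_rfl
    (by rw [Fintype.card_prod, Fintype.card_fin]; nlinarith)
  have hdiag : Derives S {fun x => if p.1 = p.2 then x .shift else 0} 3 := by
    split_ifs
    · exact (Derives.of_mem (hS .shift)).of_eq (fun _ => rfl) (by norm_num)
    · exact derives_zero
  refine ((derives_sum_mul (hgram p.1) (hgram · p.2)).add hdiag).of_eq (fun x => ?_) (by omega)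
  rw [shiftedOfInput, Matrix.add_apply, pow_two, mul_apply, Matrix.smul_apply, one_apply,
    smul_eq_mul, mul_ite, mul_one, mul_zero]

lemma derives_rhsOfInput (hS : ∀ i, (fun x => x i) ∈ S)
    (hgram : ∀ j k, (fun x => gramOfInput x j k) ∈ S) :
    Derives S (Set.range fun j x => rhsOfInput x j) ((2 * M + 3) * M) :=
  (Derives.range fun j => derives_sum_mul (hgram j) (hS <| .rhs ·)).mono subset_rfl subset_rfl
    (by rw [Fintype.card_fin, mul_comm])

lemma derives_coefficientOfInput :
    Derives (Set.range fun i (x : PostInput M → ℂ) => x i) (Set.range coefficientOfInput)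
      (80 * M ^ 3) := by
  have hsystem := (derives_gramOfInput (M := M) (Set.mem_range_self ·)).trans
    ((derives_shiftedOfInput (fun i => Or.inl ⟨i, rfl⟩) fun j k => Or.inr ⟨(j, k), rfl⟩).union
      (derives_rhsOfInput (fun i => Or.inl ⟨i, rfl⟩) fun j k => Or.inr ⟨(j, k), rfl⟩))
  have hsolution := hsystem.trans (derives_solution
    (fun i j => Or.inr (Or.inr (Or.inl ⟨(i, j), rfl⟩)))
    fun i => Or.inr (Or.inr (Or.inr ⟨i, rfl⟩)))
  have hcoeff := hsolution.trans (Derives.range (F := coefficientOfInput) fun j =>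
    (Derives.of_mem (Or.inr (Or.inr ⟨j, rfl⟩))).mul (.of_mem (Or.inl ⟨.norm j, rfl⟩)))
  refine hcoeff.mono subset_rfl Set.subset_union_right ?_
  have h₁ : M ≤ M ^ 3 := Nat.le_self_pow three_ne_zero M
  have h₂ : M ^ 2 ≤ M ^ 3 := by nlinarith [Nat.le_self_pow two_ne_zero M]
  rw [Fintype.card_fin]
  nlinarith

lemma exists_program_computesCoefficients (M : ℕ) :
    ∃ P : Program (PostInput M) (Fin M), ComputesCoefficients P ∧ P.steps ≤ 80 * M ^ 3 := by
  obtain ⟨P, hsteps, heval⟩ := (derives_coefficientOfInput (M := M)).exists_program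
  exact ⟨P, fun a c lam S z hQ j => (heval _ j).trans (coefficientOfInput_postInput hQ c j), hsteps⟩

end ClassicalPart

/-! ### The number of repetitions -/

section Parameters

variable {m : Type} [Fintype m] [DecidableEq m] {M : ℕ} {C δ : ℝ}

lemma mainFactor_nonneg (A : Matrix m (Fin M) ℂ) (c : Fin M → ℂ) (ε : ℝ) :
    0 ≤ mainFactor A c ε := by
  have : 0 ≤ cond A := mul_nonneg (norm_nonneg _) (norm_nonneg _)
  unfold mainFactor
  positivity

lemma gammaTwo_pos {a : Fin M → ℝ} (ha : a ≠ 0) : 0 < gammaTwo a := by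
  obtain ⟨j, hj⟩ := Function.ne_iff.1 ha
  exact (sq_pos_of_ne_zero hj).trans_le (sq_le_gammaTwo a j)

lemma log_two_le_log_two_div (hδ : 0 < δ) (hδ₁ : δ ≤ 1) : Real.log 2 ≤ Real.log (2 / δ) :=
  Real.log_le_log two_pos (le_div_self zero_le_two hδ hδ₁)

lemma half_lt_log_two_div (hδ : 0 < δ) (hδ₁ : δ ≤ 1) : 1 / 2 < Real.log (2 / δ) := by
  linarith [log_two_le_log_two_div hδ hδ₁, Real.log_two_gt_d9]

lemma pow_mul_exp_neg_le (hM : 0 < M) (hδ : 0 < δ) (hδ₁ : δ ≤ 1) {x : ℝ}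
    (hx : 11 * M * Real.log (2 / δ) ≤ x) : 625 ^ M * Real.exp (-x) ≤ δ := by
  have hL : 0 < Real.log (2 / δ) := by linarith [half_lt_log_two_div hδ hδ₁]
  have hM₁ : (1 : ℝ) ≤ M := by exact_mod_cast hM
  have hbase : (625 : ℝ) ≤ Real.exp (10 * Real.log (2 / δ)) := calc
    (625 : ℝ) ≤ Real.exp (Real.log 2) ^ 10 := by rw [Real.exp_log two_pos]; norm_num
    _ = Real.exp (10 * Real.log 2) := by rw [← Real.exp_nat_mul]; norm_num
    _ ≤ Real.exp (10 * Real.log (2 / δ)) := by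
      rw [Real.exp_le_exp]
      exact mul_le_mul_of_nonneg_left (log_two_le_log_two_div hδ hδ₁) (by norm_num)
  calc 625 ^ M * Real.exp (-x)
      ≤ Real.exp (10 * Real.log (2 / δ)) ^ M * Real.exp (-(11 * M * Real.log (2 / δ))) := by gcongr
    _ = Real.exp (-(M * Real.log (2 / δ))) := by
        rw [← Real.exp_nat_mul, ← Real.exp_add]
        congr 1
        ring
    _ ≤ Real.exp (-Real.log (2 / δ)) := by
        gcongr
        exact le_mul_of_one_le_left hL.le hM₁
    _ = δ / 2 := by rw [Real.exp_neg, Real.exp_log (by positivity), inv_div]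
    _ ≤ δ := half_le_self hδ.le

/-- The accuracy of a single bilinear form of the estimate `VHat` that the repetitions of the
Hadamard tests guarantee; a net argument turns it into four times as much for the norm. -/
def formAccuracy (C : ℝ) (A : Matrix m (Fin M) ℂ) (c : Fin M → ℂ) (ε : ℝ) : ℝ :=
  Real.sqrt (22 * M / sampleT C A c ε)

section Accuracy

variable {A : Matrix m (Fin M) ℂ} (c : Fin M → ℂ) (ε : ℝ)

lemma mul_mainFactor_le_sampleT (C : ℝ) (A : Matrix m (Fin M) ℂ) :
    C * (M * mainFactor A c ε) ≤ sampleT C A c ε := by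
  have : 0 ≤ specNorm A := norm_nonneg _
  exact le_add_of_nonneg_right (by positivity)

lemma div_norm_pow_le_sampleT (hC : 0 ≤ C) (A : Matrix m (Fin M) ℂ) :
    M / ‖A‖ ^ 4 ≤ sampleT C A c ε := by
  have := mainFactor_nonneg A c ε
  rw [sampleT, specNorm_eq_norm]
  exact le_add_of_nonneg_left (by positivity)

lemma sampleT_pos (hC : 0 ≤ C) (hM : 0 < M) (hA : A ≠ 0) : 0 < sampleT C A c ε := by
  have := norm_pos_iff.2 hA
  exact (by positivity : 0 < M / ‖A‖ ^ 4).trans_le (div_norm_pow_le_sampleT c ε hC A)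

lemma four_mul_formAccuracy_sq (hT : 0 ≤ sampleT C A c ε) :
    (4 * formAccuracy C A c ε) ^ 2 = 352 * M / sampleT C A c ε := by
  rw [formAccuracy, mul_pow, Real.sq_sqrt (by positivity)]
  ring

lemma four_mul_formAccuracy_le (hC : 0 ≤ C) (hM : 0 < M) (hA : A ≠ 0) :
    4 * formAccuracy C A c ε ≤ 19 * ‖A‖ ^ 2 := by
  have hT := sampleT_pos c ε hC hM hA
  have hMT : (M : ℝ) ≤ sampleT C A c ε * ‖A‖ ^ 4 :=
    (div_le_iff₀ (pow_pos (norm_pos_iff.2 hA) 4)).1 (div_norm_pow_le_sampleT c ε hC A)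
  refine le_of_sq_le_sq ?_ (by positivity)
  rw [four_mul_formAccuracy_sq c ε hT.le, div_le_iff₀ hT]
  nlinarith

lemma four_mul_formAccuracy_sq_mul_mainFactor_le (hC : 10 ^ 7 ≤ C) (hM : 0 < M) (hA : A ≠ 0) :
    (4 * formAccuracy C A c ε) ^ 2 * mainFactor A c ε ≤ (1 / 168) ^ 2 := by
  have hT := sampleT_pos c ε (by linarith) hM hA
  have hMF : 0 ≤ M * mainFactor A c ε := mul_nonneg M.cast_nonneg (mainFactor_nonneg A c ε)
  rw [four_mul_formAccuracy_sq c ε hT.le, div_mul_eq_mul_div, div_le_iff₀ hT]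
  nlinarith [mul_mainFactor_le_sampleT c ε C A]

lemma shots_pos (hC : 0 ≤ C) (hM : 0 < M) (hA : A ≠ 0) {a : Fin M → ℝ} (ha : a ≠ 0) (hδ : 0 < δ)
    (hδ₁ : δ ≤ 1) : 0 < shots C A a c ε δ := by
  have := gammaTwo_pos ha
  have := sampleT_pos c ε hC hM hA
  have : 0 < Real.log (2 / δ) := by linarith [half_lt_log_two_div hδ hδ₁]
  exact Nat.ceil_pos.2 (by positivity)

lemma le_formAccuracy_sq_div (hC : 0 ≤ C) (hM : 0 < M) (hA : A ≠ 0) {a : Fin M → ℝ} (ha : a ≠ 0)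
    (hδ : 0 < δ) (hδ₁ : δ ≤ 1) :
    11 * M * Real.log (2 / δ) ≤
      formAccuracy C A c ε ^ 2 / (2 * (gammaTwo a ^ 2 / shots C A a c ε δ)) := by
  have hT := sampleT_pos c ε hC hM hA
  have hΓ := gammaTwo_pos ha
  have hS : (0 : ℝ) < shots C A a c ε δ := by exact_mod_cast shots_pos c ε hC hM hA ha hδ hδ₁
  have hle : gammaTwo a ^ 2 * sampleT C A c ε * Real.log (2 / δ) ≤ shots C A a c ε δ :=
    Nat.le_ceil _
  calc 11 * M * Real.log (2 / δ)
      = 11 * M / (gammaTwo a ^ 2 * sampleT C A c ε) *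
          (gammaTwo a ^ 2 * sampleT C A c ε * Real.log (2 / δ)) := by field_simp
    _ ≤ 11 * M / (gammaTwo a ^ 2 * sampleT C A c ε) * shots C A a c ε δ := by gcongr
    _ = formAccuracy C A c ε ^ 2 / (2 * (gammaTwo a ^ 2 / shots C A a c ε δ)) := by
        rw [formAccuracy, Real.sq_sqrt (by positivity)]
        field_simp
        ring

end Accuracy

end Parameters

/-! ### The success probability -/

section Success

variable {n M : ℕ} {U : Fin M → Circuit (Fin n)} {a : Fin M → ℝ}

lemma ne_zero_of_sysMatrix_ne_zero (hA : sysMatrix U a ≠ 0) : a ≠ 0 := by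
  rintro rfl
  exact hA (funext₂ fun x j => by simp [sysMatrix])

lemma sysMatrix_mulVec (U : Fin M → Circuit (Fin n)) (a : Fin M → ℝ) (α : Fin M → ℂ) :
    sysMatrix U a *ᵥ α = ∑ j, (α j * (a j : ℂ)) • (U j).state := by
  funext x
  rw [Finset.sum_apply, mulVec, dotProduct]
  refine Finset.sum_congr rfl fun j _ => ?_
  rw [sysMatrix, Pi.smul_apply, smul_eq_mul]
  ring

lemma one_sub_le_measureReal_norm_VHat_sub_le_formAccuracy {C δ : ℝ}
    {test : Fin M → Fin M → Bool → Circuit (Option (Fin n))}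
    (htest : ∀ j k im, IsHadamardTest (test j k im) im ((U j).toMatrixᴴ * (U k).toMatrix))
    (hC : 0 ≤ C) (hA : sysMatrix U a ≠ 0) (c : Fin M → ℂ) (ε : ℝ) (hδ : 0 < δ) (hδ₁ : δ ≤ 1) :
    1 - δ ≤ (recordLaw test (shots C (sysMatrix U a) a c ε δ)).real
      {ω | ‖VHat a (shots C (sysMatrix U a) a c ε δ) (zeroCount ω)
        - (sysMatrix U a)ᴴ * sysMatrix U a‖ ≤ 4 * formAccuracy C (sysMatrix U a) c ε} := by
  have ha := ne_zero_of_sysMatrix_ne_zero hA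
  have hM : 0 < M := (Function.ne_iff.1 ha).choose.pos
  have hfail := pow_mul_exp_neg_le hM hδ hδ₁ (le_formAccuracy_sq_div c ε hC hM hA ha hδ hδ₁)
  rw [← neg_div] at hfail
  exact (sub_le_sub_left hfail 1).trans (one_sub_le_measureReal_norm_VHat_sub_le htest
    (shots_pos c ε hC hM hA ha hδ hδ₁) a (Real.sqrt_nonneg _))

theorem one_sub_le_measureReal_isApproxSolution {C δ ε : ℝ} {c : Fin M → ℂ}
    {test : Fin M → Fin M → Bool → Circuit (Option (Fin n))}
    (htest : ∀ j k im, IsHadamardTest (test j k im) im ((U j).toMatrixᴴ * (U k).toMatrix))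
    {P : Program (PostInput M) (Fin M)} (hP : ComputesCoefficients P) (hC : 10 ^ 7 ≤ C)
    (hA : sysMatrix U a ≠ 0) (hc : c ≠ 0) (hε : 0 < ε) (hδ : 0 < δ) (hδ₁ : δ ≤ 1) :
    1 - δ ≤ (recordLaw test (shots C (sysMatrix U a) a c ε δ)).real
      {ω | IsUnit (QHat a (shift (sysMatrix U a) c ε) (shots C (sysMatrix U a) a c ε δ)
          (zeroCount ω)).det ∧
        IsApproxSolution (sysMatrix U a) c ε (∑ j, P.eval (postInput a c (shift (sysMatrix U a) c ε)
          (shots C (sysMatrix U a) a c ε δ) (zeroCount ω)) j • (U j).state)} := by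
  have hC₀ : 0 ≤ C := by linarith
  have hM : 0 < M := (Function.ne_iff.1 hc).choose.pos
  have := isProbabilityMeasure_recordLaw htest (shots C (sysMatrix U a) a c ε δ)
  refine (one_sub_le_measureReal_norm_VHat_sub_le_formAccuracy htest hC₀ hA c ε hδ hδ₁).trans
    (MeasureTheory.measureReal_mono fun ω hω => ?_)
  obtain ⟨hdet, happrox⟩ := isApproxSolution_shiftedSolution hA hc hε hω
    (four_mul_formAccuracy_le c ε hC₀ hM hA)
    (four_mul_formAccuracy_sq_mul_mainFactor_le c ε hC hM hA)
  refine ⟨hdet, ?_⟩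
  simp only [hP _ _ _ _ _ hdet]
  rwa [← sysMatrix_mulVec]

end Success

/-! ### The running time -/

section RunningTime

lemma rate_nonneg {m : Type} [Fintype m] [DecidableEq m] {M : ℕ} (A : Matrix m (Fin M) ℂ)
    (a : Fin M → ℝ) (c : Fin M → ℂ) (ε : ℝ) : 0 ≤ rate A a c ε := by
  have := mainFactor_nonneg A c ε
  have : 0 ≤ specNorm A := norm_nonneg _
  unfold rate
  positivity

lemma sq_mul_shots_le {m : Type} [Fintype m] [DecidableEq m] {M : ℕ} {C δ : ℝ} (hC : 1 ≤ C)
    (A : Matrix m (Fin M) ℂ) (a : Fin M → ℝ) (c : Fin M → ℂ) (ε : ℝ) (hδ : 0 < δ) (hδ₁ : δ ≤ 1) :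
    (M : ℝ) ^ 2 * shots C A a c ε δ ≤ C * (Real.log (2 / δ) * rate A a c ε) + M ^ 2 := by
  have : 0 ≤ specNorm A := norm_nonneg _
  have hF := mainFactor_nonneg A c ε
  have hL : 0 < Real.log (2 / δ) := by linarith [half_lt_log_two_div hδ hδ₁]
  have hT : 0 ≤ sampleT C A c ε := by
    unfold sampleT
    positivity
  have hMT : (M : ℝ) ^ 2 * (gammaTwo a ^ 2 * sampleT C A c ε) ≤ C * rate A a c ε := by
    have hslack : 0 ≤ (C - 1) * (gammaTwo a ^ 2 * M ^ 3 / specNorm A ^ 4) :=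
      mul_nonneg (by linarith) (by positivity)
    unfold rate sampleT
    linear_combination hslack
  calc (M : ℝ) ^ 2 * shots C A a c ε δ
      ≤ M ^ 2 * (gammaTwo a ^ 2 * sampleT C A c ε * Real.log (2 / δ) + 1) := by
        gcongr
        exact (Nat.ceil_lt_add_one (by positivity)).le
    _ = M ^ 2 * (gammaTwo a ^ 2 * sampleT C A c ε) * Real.log (2 / δ) + M ^ 2 := by ring
    _ ≤ C * rate A a c ε * Real.log (2 / δ) + M ^ 2 := by gcongr
    _ = C * (Real.log (2 / δ) * rate A a c ε) + M ^ 2 := by ring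

variable {n M d : ℕ} {U : Fin M → Circuit (Fin n)} {a : Fin M → ℝ} {c : Fin M → ℂ} {C ε δ : ℝ}

lemma l2norm_state (V : Circuit (Fin n)) : l2norm V.state = 1 := by
  rw [← pow_eq_one_iff_of_nonneg (l2norm_nonneg _) two_ne_zero, l2norm_sq]
  exact sum_norm_sq_column V.toMatrix_mem_unitaryGroup _

lemma l2norm_single {ι : Type} [Fintype ι] [DecidableEq ι] (j : ι) (z : ℂ) :
    l2norm (Pi.single j z) = ‖z‖ := by
  rw [l2norm, PiLp.toLp_single (β := fun _ : ι => ℂ) 2, PiLp.norm_single]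

lemma one_le_norm_pinv_mul_abs (hlin : LinearIndependent ℂ (sysMatrix U a)ᵀ) (j : Fin M) :
    1 ≤ ‖pinv (sysMatrix U a)‖ * |a j| := by
  have hcol : l2norm (sysMatrix U a *ᵥ Pi.single j 1) = |a j| := by
    rw [sysMatrix_mulVec, Finset.sum_eq_single_of_mem j (Finset.mem_univ j) fun i _ hij => by
        rw [Pi.single_eq_of_ne hij, zero_mul, zero_smul],
      Pi.single_eq_same, one_mul, l2norm_smul, l2norm_state, mul_one, Complex.norm_real,
      Real.norm_eq_abs]
  have hle := l2norm_mulVec_le (pinv (sysMatrix U a)) (sysMatrix U a *ᵥ Pi.single j 1)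
  rwa [mulVec_mulVec, pinv_mul_self_of_linearIndependent hlin, one_mulVec, hcol, l2norm_single,
    norm_one] at hle

lemma norm_pinv_pow_le_mainFactor {m : Type} [Fintype m] [DecidableEq m]
    {A : Matrix m (Fin M) ℂ} (hA : A ≠ 0) (hε : 0 < ε) (hεc : ε ≤ l2norm c) :
    ‖pinv A‖ ^ 4 ≤ mainFactor A c ε := by
  have hκ : 1 ≤ cond A ^ 12 := one_le_pow₀ (one_le_norm_mul_norm_pinv hA)
  have hs : ε ≤ specNorm A ^ 2 * l2norm (alphaStar A c) + ε + l2norm c := by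
    have := l2norm_nonneg (alphaStar A c)
    have := l2norm_nonneg c
    have : 0 ≤ specNorm A ^ 2 * l2norm (alphaStar A c) := by positivity
    linarith
  rw [mainFactor, le_div_iff₀ (by positivity), specNorm_eq_norm (pinv A)]
  calc ‖pinv A‖ ^ 4 * ε ^ 4 = 1 * ‖pinv A‖ ^ 4 * ε ^ 2 * ε ^ 2 := by ring
    _ ≤ _ := by gcongr

lemma cube_le_rate (hA : sysMatrix U a ≠ 0) (hlin : LinearIndependent ℂ (sysMatrix U a)ᵀ)
    (hε : 0 < ε) (hεc : ε ≤ l2norm c) : (M : ℝ) ^ 3 ≤ rate (sysMatrix U a) a c ε := by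
  obtain ⟨j, -⟩ := Function.ne_iff.1 (ne_zero_of_sysMatrix_ne_zero hA)
  have : 0 ≤ specNorm (sysMatrix U a) := norm_nonneg _
  calc (M : ℝ) ^ 3 ≤ (‖pinv (sysMatrix U a)‖ * |a j|) ^ 4 * M ^ 3 :=
        le_mul_of_one_le_left (by positivity) (one_le_pow₀ (one_le_norm_pinv_mul_abs hlin j))
    _ = (a j ^ 2) ^ 2 * M ^ 3 * ‖pinv (sysMatrix U a)‖ ^ 4 := by rw [← sq_abs (a j)]; ring
    _ ≤ gammaTwo a ^ 2 * M ^ 3 * mainFactor (sysMatrix U a) c ε := by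
        gcongr
        · exact sq_le_gammaTwo a j
        · exact norm_pinv_pow_le_mainFactor hA hε hεc
    _ ≤ rate (sysMatrix U a) a c ε := le_add_of_nonneg_right (by positivity)

lemma exists_hadamardTests (hd : ∀ j, (U j).depth ≤ d) :
    ∃ test : Fin M → Fin M → Bool → Circuit (Option (Fin n)),
      (∀ j k im, IsHadamardTest (test j k im) im ((U j).toMatrixᴴ * (U k).toMatrix)) ∧
      ∀ j k im, (test j k im).depth ≤ 14 * ((n + 1) * (d + 1)) := by
  choose test htest hdepth using fun j k => exists_hadamardTest (U j) (U k) (hd j) (hd k)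
  exact ⟨test, htest, by simpa only [Fintype.card_fin] using hdepth⟩

variable {test : Fin M → Fin M → Bool → Circuit (Option (Fin n))}
  {P : Program (PostInput M) (Fin M)}

lemma runTime_le {D : ℕ} (htest : ∀ j k im, (test j k im).depth < D) (S : ℕ)
    (P : Program (PostInput M) (Fin M)) : runTime test S P ≤ 2 * D * (M ^ 2 * S) + P.steps := by
  refine Nat.add_le_add_right ?_ _
  calc ∑ j, ∑ k, ∑ im, S * ((test j k im).depth + 1)
      ≤ ∑ _j : Fin M, ∑ _k : Fin M, ∑ _im : Bool, S * D := by
        gcongr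
        exact htest _ _ _
    _ = 2 * D * (M ^ 2 * S) := by
        simp only [Finset.sum_const, Finset.card_univ, Fintype.card_fin, Fintype.card_bool,
          smul_eq_mul]
        ring

variable (hdepth : ∀ j k im, (test j k im).depth ≤ 14 * ((n + 1) * (d + 1)))
  (hsteps : P.steps ≤ 80 * M ^ 3) (hC : 1 ≤ C) (hδ : 0 < δ) (hδ₁ : δ ≤ 1)

include hdepth hsteps hC hδ hδ₁

lemma runTime_shots_le (U : Fin M → Circuit (Fin n)) (a : Fin M → ℝ) (c : Fin M → ℂ) (ε : ℝ) :
    (runTime test (shots C (sysMatrix U a) a c ε δ) P : ℝ) ≤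
      30 * ((n + 1) * (d + 1)) * (C * (Real.log (2 / δ) * rate (sysMatrix U a) a c ε) + M ^ 2)
        + 80 * M ^ 3 := by
  have hlt : ∀ j k im, (test j k im).depth < 15 * ((n + 1) * (d + 1)) := fun j k im => by
    have := hdepth j k im
    have : 0 < (n + 1) * (d + 1) := by positivity
    omega
  calc (runTime test (shots C (sysMatrix U a) a c ε δ) P : ℝ)
      ≤ 2 * (15 * ((n + 1) * (d + 1))) * (M ^ 2 * shots C (sysMatrix U a) a c ε δ)
          + 80 * M ^ 3 := by
        exact_mod_cast (runTime_le hlt _ P).trans (Nat.add_le_add_left hsteps _)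
    _ ≤ 2 * (15 * ((n + 1) * (d + 1)))
          * (C * (Real.log (2 / δ) * rate (sysMatrix U a) a c ε) + M ^ 2) + 80 * M ^ 3 := by
        gcongr
        exact sq_mul_shots_le hC (sysMatrix U a) a c ε hδ hδ₁
    _ = _ := by ring

theorem runTime_shots_le_mul_add (U : Fin M → Circuit (Fin n)) (a : Fin M → ℝ) (c : Fin M → ℂ)
    (ε : ℝ) :
    (runTime test (shots C (sysMatrix U a) a c ε δ) P : ℝ) ≤
      250 * C * ((n + 1) * (d + 1) *
        (Real.log (2 / δ) * rate (sysMatrix U a) a c ε + M ^ 2) + M ^ 3) := by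
  have hLR : 0 ≤ Real.log (2 / δ) * rate (sysMatrix U a) a c ε :=
    mul_nonneg (by linarith [half_lt_log_two_div hδ hδ₁]) (rate_nonneg _ a c ε)
  refine (runTime_shots_le hdepth hsteps hC hδ hδ₁ U a c ε).trans ?_
  calc (30 : ℝ) * ((n + 1) * (d + 1))
          * (C * (Real.log (2 / δ) * rate (sysMatrix U a) a c ε) + M ^ 2) + 80 * M ^ 3
      ≤ 250 * ((n + 1) * (d + 1))
          * (C * (Real.log (2 / δ) * rate (sysMatrix U a) a c ε) + C * M ^ 2)
          + 250 * (C * M ^ 3) := by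
        gcongr ?_ * _ * (_ + ?_) + ?_ * ?_
        · norm_num
        · exact le_mul_of_one_le_left (by positivity) hC
        · norm_num
        · exact le_mul_of_one_le_left (by positivity) hC
    _ = _ := by ring

theorem runTime_shots_le_mul_of_linearIndependent (hA : sysMatrix U a ≠ 0)
    (hlin : LinearIndependent ℂ (sysMatrix U a)ᵀ) (hε : 0 < ε) (hεc : ε ≤ l2norm c) :
    (runTime test (shots C (sysMatrix U a) a c ε δ) P : ℝ) ≤
      250 * C * ((n + 1) * (d + 1) * Real.log (2 / δ) * rate (sysMatrix U a) a c ε) := by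
  have hcube := cube_le_rate hA hlin hε hεc
  have hD : (1 : ℝ) ≤ (n + 1) * (d + 1) := by exact_mod_cast Nat.mul_pos n.succ_pos d.succ_pos
  have hM : (M : ℝ) ^ 2 ≤ M ^ 3 := by
    exact_mod_cast (show M ^ 2 ≤ M ^ 3 by nlinarith [Nat.le_self_pow two_ne_zero M])
  have hR : rate (sysMatrix U a) a c ε ≤ 2 * (Real.log (2 / δ) * rate (sysMatrix U a) a c ε) := by
    nlinarith [half_lt_log_two_div hδ hδ₁, rate_nonneg (sysMatrix U a) a c ε]
  have hLR : 0 ≤ Real.log (2 / δ) * rate (sysMatrix U a) a c ε := by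
    linarith [rate_nonneg (sysMatrix U a) a c ε]
  calc (runTime test (shots C (sysMatrix U a) a c ε δ) P : ℝ)
      ≤ 30 * ((n + 1) * (d + 1)) * (C * (Real.log (2 / δ) * rate (sysMatrix U a) a c ε) + M ^ 2)
          + 1 * (80 * M ^ 3) :=
        (runTime_shots_le hdepth hsteps hC hδ hδ₁ U a c ε).trans_eq (by rw [one_mul])
    _ ≤ 30 * ((n + 1) * (d + 1)) * (C * (Real.log (2 / δ) * rate (sysMatrix U a) a c ε)
            + C * (2 * (Real.log (2 / δ) * rate (sysMatrix U a) a c ε)))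
          + (n + 1) * (d + 1) *
            (80 * (C * (2 * (Real.log (2 / δ) * rate (sysMatrix U a) a c ε)))) := by
        gcongr
        · exact (hM.trans (hcube.trans hR)).trans (le_mul_of_one_le_left (by linarith) hC)
        · exact (hcube.trans hR).trans (le_mul_of_one_le_left (by linarith) hC)
    _ = 250 * C * ((n + 1) * (d + 1) * Real.log (2 / δ) * rate (sysMatrix U a) a c ε) := by ring

end RunningTime

end SkewedLS

end

theorem mainTheorem2 :
    ∃ C K : ℝ, 0 < C ∧ 0 < K ∧
      ∀ M : ℕ, ∃ P : SkewedLS.Program (SkewedLS.PostInput M) (Fin M),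
        SkewedLS.ComputesCoefficients P ∧
        ∀ (n d : ℕ) (U : Fin M → SkewedLS.Circuit (Fin n)) (a : Fin M → ℝ) (c : Fin M → ℂ)
          (ε δ : ℝ),
          (∀ j, (U j).depth ≤ d) → (∀ j, 0 ≤ a j) → SkewedLS.sysMatrix U a ≠ 0 → c ≠ 0 →
          0 < ε → 0 < δ → δ < 1 →
          ∃ test : Fin M → Fin M → Bool → SkewedLS.Circuit (Option (Fin n)),
            (∀ j k im, SkewedLS.IsHadamardTest (test j k im) im
              ((U j).toMatrix.conjTranspose * (U k).toMatrix)) ∧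
            (1 - δ ≤ (SkewedLS.recordLaw test
                (SkewedLS.shots C (SkewedLS.sysMatrix U a) a c ε δ)).real
              {ω | IsUnit (SkewedLS.QHat a (SkewedLS.shift (SkewedLS.sysMatrix U a) c ε)
                    (SkewedLS.shots C (SkewedLS.sysMatrix U a) a c ε δ)
                    (SkewedLS.zeroCount ω)).det ∧
                  SkewedLS.IsApproxSolution (SkewedLS.sysMatrix U a) c ε
                    (∑ j, P.eval (SkewedLS.postInput a c
                        (SkewedLS.shift (SkewedLS.sysMatrix U a) c ε)
                        (SkewedLS.shots C (SkewedLS.sysMatrix U a) a c ε δ)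
                        (SkewedLS.zeroCount ω)) j • (U j).state)}) ∧
            ((SkewedLS.runTime test (SkewedLS.shots C (SkewedLS.sysMatrix U a) a c ε δ) P : ℝ) ≤
              K * ((n + 1) * (d + 1) *
                  (Real.log (2 / δ) * SkewedLS.rate (SkewedLS.sysMatrix U a) a c ε + M ^ 2)
                + M ^ 3)) ∧
            (LinearIndependent ℂ (SkewedLS.sysMatrix U a).transpose → ε ≤ SkewedLS.l2norm c →
              (SkewedLS.runTime test (SkewedLS.shots C (SkewedLS.sysMatrix U a) a c ε δ) P : ℝ) ≤
                K * ((n + 1) * (d + 1) * Real.log (2 / δ) *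
                  SkewedLS.rate (SkewedLS.sysMatrix U a) a c ε)) := by
  refine ⟨10 ^ 7, 250 * 10 ^ 7, by norm_num, by norm_num, fun M => ?_⟩
  obtain ⟨P, hP, hsteps⟩ := SkewedLS.exists_program_computesCoefficients M
  refine ⟨P, hP, fun n d U a c ε δ hd _ hA hc hε hδ hδ₁ => ?_⟩
  obtain ⟨test, htest, hdepth⟩ := SkewedLS.exists_hadamardTests hd
  have hC : (1 : ℝ) ≤ 10 ^ 7 := by norm_num
  exact ⟨test, htest,
    SkewedLS.one_sub_le_measureReal_isApproxSolution htest hP le_rfl hA hc hε hδ hδ₁.le,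
    SkewedLS.runTime_shots_le_mul_add hdepth hsteps hC hδ hδ₁.le U a c ε,
    fun hlin => SkewedLS.runTime_shots_le_mul_of_linearIndependent hdepth hsteps hC hδ hδ₁.le hA
      hlin hε⟩
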